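/- Let $N\ge 2$, let $B_1^c=\{x\in\mathbb{R}^N : |x|>1\}$, and let $K:B_1^c\to(0,\infty)$ be a continuous function for which there exist constants $C>0$ and $\gamma>N$ such that $K(x)\le C|x|^{-\gamma}$ for all $|x|>1$. Let $\mathcal D^{1,N}_0(B_1^c)$ be the Beppo-Levi space, i.e. the completion of the space $C_c^\infty(B_1^c)$ of smooth real functions with compact support in $B_1^c$ with respect to the norm $\|u\|=\left(\int_{B_1^c}|\nabla u|^N\,dx\right)^{1/N}$, and for $r\in[1,\infty)$ let $L^r(B_1^c;K)$ be the Lebesgue space with norm $\left(\int_{B_1^c}|u|^rK(x)\,dx\right)^{1/r}$. Then for every $r\in[1,\infty)$ the space $\mathcal D^{1,N}_0(B_1^c)$ is continuously and compactly embedded into $L^r(B_1^c;K)$; that is, the inclusion $C_c^\infty(B_1^c)\subset L^r(B_1^c;K)$ extends to an injective bounded linear map $\mathcal D^{1,N}_0(B_1^c)\to L^r(B_1^c;K)$, and this map is a compact operator. -/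

import Mathlib

open MeasureTheory TopologicalSpace
open scoped ENNReal Gradient

noncomputable section

/-- The exterior `{x ∈ ℝᴺ : |x| > 1}` of the closed unit ball, as an open set. -/
def unitBallExterior (N : ℕ) : Opens (EuclideanSpace ℝ (Fin N)) :=
  ⟨{x | 1 < ‖x‖}, isOpen_lt continuous_const continuous_norm⟩

/-- The vector space of smooth real functions with compact support inside the exterior of the unit
ball. It is a type synonym of Mathlib's test functions, so that it can carry the gradient norm
(instead of the LF topology). -/
def ExteriorTest (N : ℕ) : Type := TestFunction (unitBallExterior N) ℝ ⊤

namespace ExteriorTest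

variable {N : ℕ}

instance : AddCommGroup (ExteriorTest N) :=
  inferInstanceAs (AddCommGroup (TestFunction (unitBallExterior N) ℝ ⊤))

instance : Module ℝ (ExteriorTest N) :=
  inferInstanceAs (Module ℝ (TestFunction (unitBallExterior N) ℝ ⊤))

instance : FunLike (ExteriorTest N) (EuclideanSpace ℝ (Fin N)) ℝ :=
  inferInstanceAs (FunLike (TestFunction (unitBallExterior N) ℝ ⊤) _ _)

/-- The Dirichlet norm `(∫_{|x|>1} |∇φ|ᴺ dx)^{1/N}`. -/
instance : Norm (ExteriorTest N) :=
  ⟨fun φ => (∫ x in (unitBallExterior N : Set (EuclideanSpace ℝ (Fin N))),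
    ‖∇ φ x‖ ^ N) ^ (1 / (N : ℝ))⟩

theorem norm_eq (φ : ExteriorTest N) :
    ‖φ‖ = (∫ x in (unitBallExterior N : Set (EuclideanSpace ℝ (Fin N))),
      ‖∇ φ x‖ ^ N) ^ (1 / (N : ℝ)) := rfl

theorem contDiff (φ : ExteriorTest N) : ContDiff ℝ ((⊤ : ℕ∞) : WithTop ℕ∞) φ :=
  TestFunction.contDiff (Ω := unitBallExterior N) φ

theorem hasCompactSupport (φ : ExteriorTest N) : HasCompactSupport φ :=
  TestFunction.hasCompactSupport (Ω := unitBallExterior N) φ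

theorem tsupport_subset (φ : ExteriorTest N) :
    tsupport φ ⊆ (unitBallExterior N : Set (EuclideanSpace ℝ (Fin N))) :=
  TestFunction.tsupport_subset (Ω := unitBallExterior N) φ

theorem differentiable (φ : ExteriorTest N) : Differentiable ℝ φ :=
  φ.contDiff.differentiable (by simp)

theorem add_coe (φ ψ : ExteriorTest N) : ⇑(φ + ψ) = ⇑φ + ⇑ψ := rfl

theorem smul_coe (c : ℝ) (φ : ExteriorTest N) :
    ⇑(c • φ) = c • ⇑φ := rfl

theorem grad_eq (φ : ExteriorTest N) (x : EuclideanSpace ℝ (Fin N)) :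
    ∇ φ x = (InnerProductSpace.toDual ℝ _).symm (fderiv ℝ φ x) := rfl

theorem continuous_grad (φ : ExteriorTest N) : Continuous (∇ φ) :=
  (InnerProductSpace.toDual ℝ _).symm.continuous.comp
    (φ.contDiff.continuous_fderiv (by simp))

theorem hasCompactSupport_grad (φ : ExteriorTest N) : HasCompactSupport (∇ φ) :=
  (φ.hasCompactSupport.fderiv ℝ).comp_left
    (g := (InnerProductSpace.toDual ℝ _).symm) (map_zero _)

theorem memLp_grad (φ : ExteriorTest N) (p : ℝ≥0∞) :
    MemLp (∇ φ) p (volume.restrict (unitBallExterior N : Set (EuclideanSpace ℝ (Fin N)))) :=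
  (φ.continuous_grad.memLp_of_hasCompactSupport φ.hasCompactSupport_grad).restrict _

theorem grad_add (φ ψ : ExteriorTest N) : ∇ (φ + ψ : ExteriorTest N) = ∇ φ + ∇ ψ := by
  ext1 x
  rw [Pi.add_apply, grad_eq, grad_eq, grad_eq, add_coe, fderiv_add (φ.differentiable x) (ψ.differentiable x), map_add]

theorem grad_smul (c : ℝ) (φ : ExteriorTest N) : ∇ (c • φ : ExteriorTest N) = c • ∇ φ := by
  ext1 x
  rw [Pi.smul_apply, grad_eq, grad_eq, smul_coe, fderiv_const_smul (φ.differentiable x), map_smulₛₗ]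
  simp

theorem norm_eq_eLpNorm (hN : N ≠ 0) (φ : ExteriorTest N) :
    ‖φ‖ = (eLpNorm (∇ φ) N
      (volume.restrict (unitBallExterior N : Set (EuclideanSpace ℝ (Fin N))))).toReal := by
  rw [(φ.memLp_grad N).eLpNorm_eq_integral_rpow_norm (by simpa using hN) (by simp), norm_eq,
    ENNReal.toReal_ofReal (by positivity)]
  simp

theorem eq_zero_of_norm_eq_zero (hN : N ≠ 0) (φ : ExteriorTest N) (h : ‖φ‖ = 0) : φ = 0 := by
  rw [norm_eq_eLpNorm hN, ENNReal.toReal_eq_zero_iff] at h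
  have h0 := h.resolve_right (φ.memLp_grad N).eLpNorm_ne_top
  rw [eLpNorm_eq_zero_iff (φ.memLp_grad N).1 (by simpa using hN)] at h0
  have hopen : IsOpen (unitBallExterior N : Set (EuclideanSpace ℝ (Fin N))) :=
    (unitBallExterior N).isOpen
  have hon : Set.EqOn (∇ φ) 0 (unitBallExterior N : Set (EuclideanSpace ℝ (Fin N))) :=
    Measure.eqOn_open_of_ae_eq h0 hopen φ.continuous_grad.continuousOn continuousOn_const
  have hfd : ∀ x, fderiv ℝ φ x = 0 := by
    intro x
    by_cases hx : x ∈ (unitBallExterior N : Set (EuclideanSpace ℝ (Fin N)))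
    · simpa [grad_eq] using hon hx
    · exact image_eq_zero_of_notMem_tsupport
        fun hx' => hx (φ.tsupport_subset (tsupport_fderiv_subset ℝ hx'))
  have hz : φ 0 = 0 := by
    apply image_eq_zero_of_notMem_tsupport
    intro hx
    have : (1 : ℝ) < ‖(0 : EuclideanSpace ℝ (Fin N))‖ := φ.tsupport_subset hx
    norm_num at this
  refine DFunLike.ext _ _ fun x => ?_
  exact (is_const_of_fderiv_eq_zero φ.differentiable hfd x 0).trans hz

variable [Fact (2 ≤ N)]

theorem dim_ne_zero : N ≠ 0 := by
  have := Fact.out (p := 2 ≤ N)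
  lia

theorem normedSpaceCore : NormedSpace.Core ℝ (ExteriorTest N) where
  norm_nonneg φ := by rw [norm_eq]; positivity
  norm_smul c φ := by
    rw [norm_eq_eLpNorm dim_ne_zero, norm_eq_eLpNorm dim_ne_zero, grad_smul,
      eLpNorm_const_smul, ENNReal.toReal_mul]
    simp
  norm_triangle φ ψ := by
    have h1 : (1 : ℝ≥0∞) ≤ N := by
      exact_mod_cast Nat.one_le_iff_ne_zero.mpr dim_ne_zero
    simp only [norm_eq_eLpNorm dim_ne_zero, grad_add]
    rw [← ENNReal.toReal_add (φ.memLp_grad N).eLpNorm_ne_top (ψ.memLp_grad N).eLpNorm_ne_top]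
    exact ENNReal.toReal_mono
      (ENNReal.add_ne_top.mpr ⟨(φ.memLp_grad N).eLpNorm_ne_top, (ψ.memLp_grad N).eLpNorm_ne_top⟩)
      (eLpNorm_add_le (φ.memLp_grad N).1 (ψ.memLp_grad N).1 h1)
  norm_eq_zero_iff φ := by
    refine ⟨eq_zero_of_norm_eq_zero dim_ne_zero φ, ?_⟩
    rintro rfl
    have h : ∇ (0 : ExteriorTest N) = 0 := by
      have := grad_smul (0 : ℝ) (0 : ExteriorTest N)
      rwa [smul_zero, zero_smul] at this
    rw [norm_eq_eLpNorm dim_ne_zero, h]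
    simp

instance : NormedAddCommGroup (ExteriorTest N) := NormedAddCommGroup.ofCore normedSpaceCore

instance : NormedSpace ℝ (ExteriorTest N) := NormedSpace.ofCore normedSpaceCore

end ExteriorTest

/-- The Beppo-Levi space `D₀^{1,N}` of the exterior of the unit ball: the completion of the
compactly supported smooth functions with respect to `(∫ |∇φ|ᴺ)^{1/N}`. -/
abbrev BeppoLevi (N : ℕ) [Fact (2 ≤ N)] : Type := UniformSpace.Completion (ExteriorTest N)

/-- The measure `K(x) dx` on the exterior of the unit ball. -/
def weightedMeasure (N : ℕ) (K : EuclideanSpace ℝ (Fin N) → ℝ) :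
    Measure (EuclideanSpace ℝ (Fin N)) :=
  (volume.restrict (unitBallExterior N : Set (EuclideanSpace ℝ (Fin N)))).withDensity
    fun x => ENNReal.ofReal (K x)

end

/-
For the model weight `|x|^(-γ)`, integrating `f'` along the segment from `0` to `x` and scaling
give the Hardy inequality `∫ |f| |x|^(-(c+1)) ≤ C ∫ |∇f| |x|^(-c)` for `c + 1 > N`. Combined with
the Gagliardo-Nirenberg-Sobolev inequality for `|x|^(-c) f`, it bounds the `L^p` norm of this
function, `p = N/(N-1)`, by `∫ |∇f| |x|^(-c)`. Taking `f = φ^(s+1)`, `c = γ/p`, and applying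
Hölder's inequality, one gets `‖φ^(s+1)‖_p ≤ C ‖φ^s‖_p ‖∇φ‖_N` in the weighted spaces. By
induction on `s` every power of `φ` is controlled in `L^p`; the weighted measure being finite,
every `L^r` norm of `φ` is controlled by `‖∇φ‖_N`.

For compactness at `r = N`, a test function differs in `L^N` from its averages over balls of
radius `ρ` by at most `ρ ‖∇φ‖_N`. These averages are Lipschitz with a constant controlled by
`‖∇φ‖_N`, so on a bounded set they are controlled by finitely many of their values; near infinity
`φ` is small by the embedding for a weight `|x|^(-γ')` with `N < γ' < γ`. The other exponents
follow by interpolating between `L^1` and `L^(2r-1)`.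

The gradient extends isometrically to the Beppo-Levi space, and `∫ ψ ∇u = -∫ u ∇ψ` for test
functions `ψ` passes to the limit. If the image of `u` in `L^r` vanishes, so does its gradient,
hence `u = 0`. General weights reduce to the model weight: the two measures have the same null
sets, and one is dominated by a multiple of the other.
-/

noncomputable section

open scoped NNReal

section Minkowski

variable {α β : Type*} [MeasurableSpace α] [MeasurableSpace β] {μ : Measure α} [SFinite μ]
  {ν : Measure β} [IsProbabilityMeasure ν]

theorem eLpNorm_lintegral_le {p : ℝ≥0∞} (hp1 : 1 ≤ p) (hp : p ≠ ∞) {g : α → β → ℝ≥0∞}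
    (hg : Measurable (Function.uncurry g)) {M : ℝ≥0∞}
    (hM : ∀ᵐ t ∂ν, eLpNorm (fun x => g x t) p μ ≤ M) :
    eLpNorm (fun x => ∫⁻ t, g x t ∂ν) p μ ≤ M := by
  have hp0 : 0 < p.toReal := ENNReal.toReal_pos (zero_lt_one.trans_le hp1).ne' hp
  have hp1' : 1 ≤ p.toReal := by simpa using ENNReal.toReal_mono hp hp1
  have key (h : α → ℝ≥0∞) : eLpNorm h p μ ≤ M ↔ ∫⁻ x, h x ^ p.toReal ∂μ ≤ M ^ p.toReal := by
    rw [eLpNorm_eq_lintegral_rpow_enorm_toReal (zero_lt_one.trans_le hp1).ne' hp, one_div,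
      ENNReal.rpow_inv_le_iff hp0]
    simp only [enorm_eq_self]
  simp only [key] at hM ⊢
  have jensen (x : α) : (∫⁻ t, g x t ∂ν) ^ p.toReal ≤ ∫⁻ t, g x t ^ p.toReal ∂ν := by
    have := eLpNorm'_le_eLpNorm'_of_exponent_le zero_lt_one hp1' ν
      (hg.of_uncurry_left (x := x)).aestronglyMeasurable
    simpa [eLpNorm', ENNReal.le_rpow_inv_iff hp0] using this
  calc ∫⁻ x, (∫⁻ t, g x t ∂ν) ^ p.toReal ∂μ
      ≤ ∫⁻ x, ∫⁻ t, g x t ^ p.toReal ∂ν ∂μ := lintegral_mono jensen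
    _ = ∫⁻ t, ∫⁻ x, g x t ^ p.toReal ∂μ ∂ν :=
        lintegral_lintegral_swap (hg.pow_const _).aemeasurable
    _ ≤ ∫⁻ _, M ^ p.toReal ∂ν := lintegral_mono_ae hM
    _ = M ^ p.toReal := by simp

end Minkowski

section Translation

variable {E F : Type*} [NormedAddCommGroup E] [NormedSpace ℝ E]
  [NormedAddCommGroup F] [NormedSpace ℝ F] {f : E → F}

theorem enorm_sub_le_lintegral_enorm_fderiv (hf : ContDiff ℝ 1 f) (x h : E) :
    ‖f (x + h) - f x‖ₑ ≤ ∫⁻ t in Set.Ioc (0 : ℝ) 1, ‖h‖ₑ * ‖fderiv ℝ f (x + t • h)‖ₑ := by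
  have hderiv (t : ℝ) :
      HasDerivAt (fun t : ℝ => f (x + t • h)) (fderiv ℝ f (x + t • h) h) t := by
    have hline : HasDerivAt (fun t : ℝ => x + t • h) h t := by
      simpa using ((hasDerivAt_id t).smul_const h).const_add x
    exact (hf.differentiable one_ne_zero _).hasFDerivAt.comp_hasDerivAt t hline
  have hC1 : ContDiff ℝ 1 fun t : ℝ => f (x + t • h) := by fun_prop
  calc ‖f (x + h) - f x‖ₑ
      ≤ ∫⁻ t in Set.Icc (0 : ℝ) 1, ‖deriv (fun t : ℝ => f (x + t • h)) t‖ₑ := by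
        simpa using
          enorm_sub_le_lintegral_deriv_of_contDiffOn_Icc hC1.contDiffOn (zero_le_one (α := ℝ))
    _ ≤ ∫⁻ t in Set.Icc (0 : ℝ) 1, ‖h‖ₑ * ‖fderiv ℝ f (x + t • h)‖ₑ := by
        refine lintegral_mono fun t => ?_
        rw [(hderiv t).deriv, mul_comm]
        exact ContinuousLinearMap.le_opENorm _ _
    _ = _ := by rw [restrict_Ioc_eq_restrict_Icc]

variable [MeasurableSpace E] [FiniteDimensional ℝ E] (μ : Measure E) [μ.IsAddHaarMeasure]

theorem isProbabilityMeasure_cond_ball {ρ : ℝ} (hρ : 0 < ρ) :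
    IsProbabilityMeasure (ProbabilityTheory.cond μ (Metric.ball (0 : E) ρ)) :=
  ProbabilityTheory.cond_isProbabilityMeasure_of_finite
    (Metric.measure_ball_pos μ 0 hρ).ne' measure_ball_lt_top.ne

variable [BorelSpace E]

theorem eLpNorm_comp_add_sub_le (hf : ContDiff ℝ 1 f) {p : ℝ≥0∞} (hp1 : 1 ≤ p) (hp : p ≠ ∞)
    (h : E) :
    eLpNorm (fun x => f (x + h) - f x) p μ ≤ ‖h‖ₑ * eLpNorm (fderiv ℝ f) p μ := by
  have hcont : Continuous fun x => ‖fderiv ℝ f x‖ₑ := (hf.continuous_fderiv one_ne_zero).enorm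
  have hprob : IsProbabilityMeasure (volume.restrict (Set.Ioc (0 : ℝ) 1)) := ⟨by simp⟩
  refine (eLpNorm_mono_enorm (g := fun x => ∫⁻ t in Set.Ioc (0 : ℝ) 1,
    ‖h‖ₑ * ‖fderiv ℝ f (x + t • h)‖ₑ) fun x => ?_).trans
    (eLpNorm_lintegral_le hp1 hp ?_ (Filter.Eventually.of_forall fun t => ?_))
  · exact (enorm_sub_le_lintegral_enorm_fderiv hf x h).trans_eq (enorm_eq_self _).symm
  · have hseg : Continuous fun q : E × ℝ => q.1 + q.2 • h := by fun_prop
    exact (hcont.comp hseg).measurable.const_mul _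
  · calc eLpNorm (fun x => ‖h‖ₑ * ‖fderiv ℝ f (x + t • h)‖ₑ) p μ
        ≤ ‖h‖ₑ * eLpNorm (fderiv ℝ f ∘ (· + t • h)) p μ :=
          eLpNorm_le_mul_eLpNorm_of_ae_le_mul' (c := ‖h‖₊)
            (.of_forall fun x => (enorm_eq_self _).le) p
      _ = ‖h‖ₑ * eLpNorm (fderiv ℝ f) p μ := by
          rw [eLpNorm_comp_measurePreserving
            (hf.continuous_fderiv one_ne_zero).aestronglyMeasurable
            (measurePreserving_add_right μ (t • h))]

/-- The average of `f` over the ball of radius `ρ` around `x`, written as a mean of translates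
of `f` so that the translation estimate applies. -/
def ballAverage (ρ : ℝ) (f : E → F) (x : E) : F :=
  ∫ h, f (x + h) ∂ProbabilityTheory.cond μ (Metric.ball 0 ρ)

variable {ρ : ℝ}

theorem integrable_comp_add_cond_ball {G : Type*} [NormedAddCommGroup G] {g : E → G} (hρ : 0 < ρ)
    (hg : Continuous g) (x : E) :
    Integrable (fun h => g (x + h)) (ProbabilityTheory.cond μ (Metric.ball (0 : E) ρ)) := by
  have hcont : Continuous fun h => g (x + h) := by fun_prop
  exact ((hcont.continuousOn.integrableOn_compact (isCompact_closedBall 0 ρ)).mono_set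
    Metric.ball_subset_closedBall).integrable.smul_measure
      (ENNReal.inv_ne_top.2 (Metric.measure_ball_pos μ 0 hρ).ne')

theorem eLpNorm_sub_ballAverage_le [CompleteSpace F] (hf : ContDiff ℝ 1 f) {p : ℝ≥0∞}
    (hp1 : 1 ≤ p) (hp : p ≠ ∞) (hρ : 0 < ρ) :
    eLpNorm (fun x => f x - ballAverage μ ρ f x) p μ ≤
      ENNReal.ofReal ρ * eLpNorm (fderiv ℝ f) p μ := by
  have := isProbabilityMeasure_cond_ball μ hρ
  set ν := ProbabilityTheory.cond μ (Metric.ball (0 : E) ρ)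
  have hcont : Continuous fun q : E × E => ‖f (q.1 + q.2) - f q.1‖ₑ := by
    have := hf.continuous
    fun_prop
  refine (eLpNorm_mono_enorm (g := fun x => ∫⁻ h, ‖f (x + h) - f x‖ₑ ∂ν) fun x => ?_).trans
    (eLpNorm_lintegral_le hp1 hp hcont.measurable ?_)
  · calc ‖f x - ballAverage μ ρ f x‖ₑ = ‖∫ h, f (x + h) - f x ∂ν‖ₑ := by
          rw [integral_sub (integrable_comp_add_cond_ball μ hρ hf.continuous x)
            (integrable_const _), integral_const, probReal_univ, one_smul, enorm_sub_rev,
            ballAverage]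
      _ ≤ _ := (enorm_integral_le_lintegral_enorm _).trans_eq (enorm_eq_self _).symm
  · filter_upwards [ProbabilityTheory.ae_cond_mem measurableSet_ball] with h hh
    rw [eLpNorm_enorm]
    refine (eLpNorm_comp_add_sub_le μ hf hp1 hp h).trans ?_
    gcongr
    rw [← ofReal_norm]
    exact ENNReal.ofReal_le_ofReal (mem_ball_zero_iff.1 hh).le

theorem enorm_ballAverage_sub_le (hf : ContDiff ℝ 1 f) {p : ℝ≥0∞} (hp1 : 1 ≤ p) (hp : p ≠ ∞)
    (hρ : 0 < ρ) (x y : E) :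
    ‖ballAverage μ ρ f x - ballAverage μ ρ f y‖ₑ ≤
      (μ (Metric.ball 0 ρ))⁻¹ ^ (1 / p).toReal * eLpNorm (fderiv ℝ f) p μ * ‖x - y‖ₑ := by
  have := isProbabilityMeasure_cond_ball μ hρ
  set ν := ProbabilityTheory.cond μ (Metric.ball (0 : E) ρ)
  have hcont := hf.continuous
  have hdiff : Continuous fun h => f (x + h) - f (y + h) := by fun_prop
  calc ‖ballAverage μ ρ f x - ballAverage μ ρ f y‖ₑ
      = ‖∫ h, f (x + h) - f (y + h) ∂ν‖ₑ := by
        rw [integral_sub (integrable_comp_add_cond_ball μ hρ hcont x)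
          (integrable_comp_add_cond_ball μ hρ hcont y), ballAverage, ballAverage]
    _ ≤ eLpNorm (fun h => f (x + h) - f (y + h)) 1 ν := by
        rw [eLpNorm_one_eq_lintegral_enorm]
        exact enorm_integral_le_lintegral_enorm _
    _ ≤ eLpNorm (fun h => f (x + h) - f (y + h)) p ν :=
        eLpNorm_le_eLpNorm_of_exponent_le hp1 hdiff.aestronglyMeasurable
    _ ≤ (μ (Metric.ball 0 ρ))⁻¹ ^ (1 / p).toReal *
          eLpNorm (fun h => f (x + h) - f (y + h)) p μ :=
        eLpNorm_le_of_measure_le_smul (smul_mono_right _ Measure.restrict_le_self)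
    _ = (μ (Metric.ball 0 ρ))⁻¹ ^ (1 / p).toReal *
          eLpNorm ((fun z => f (z + (x - y)) - f z) ∘ (y + ·)) p μ := by
        congr 2 with h
        rw [Function.comp_apply, show y + h + (x - y) = x + h by abel]
    _ ≤ _ := by
        rw [eLpNorm_comp_measurePreserving (by fun_prop) (measurePreserving_add_left μ y),
          mul_assoc, mul_comm (eLpNorm _ _ _)]
        gcongr
        exact eLpNorm_comp_add_sub_le μ hf hp1 hp _

end Translation

section Hardy

variable {E F : Type*} [NormedAddCommGroup E] [NormedSpace ℝ E]
  [NormedAddCommGroup F] [NormedSpace ℝ F] {f : E → F} {c : ℝ}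

theorem enorm_mul_enorm_norm_rpow_neg (c : ℝ) {t : ℝ} (ht : 0 < t) {x : E} (hx : x ≠ 0) :
    ‖x‖ₑ * ‖‖x‖ ^ (-(c + 1))‖ₑ = ENNReal.ofReal (t ^ c) * ‖‖t • x‖ ^ (-c)‖ₑ := by
  have hx : 0 < ‖x‖ := norm_pos_iff.2 hx
  have hlhs : ‖x‖ * ‖x‖ ^ (-(c + 1)) = ‖x‖ ^ (-c) := by
    rw [neg_add, ← sub_eq_add_neg, Real.rpow_sub_one hx.ne', mul_div_cancel₀ _ hx.ne']
  have hrhs : t ^ c * ‖t • x‖ ^ (-c) = ‖x‖ ^ (-c) := by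
    rw [norm_smul, Real.norm_of_nonneg ht.le, Real.mul_rpow ht.le hx.le, ← mul_assoc,
      ← Real.rpow_add ht, add_neg_cancel, Real.rpow_zero, one_mul]
  rw [← ofReal_norm, Real.enorm_of_nonneg (by positivity), Real.enorm_of_nonneg (by positivity),
    ← ENNReal.ofReal_mul (by positivity), ← ENNReal.ofReal_mul (by positivity), hlhs, hrhs]

theorem enorm_mul_norm_rpow_neg_le_lintegral (hf : ContDiff ℝ 1 f) (h0 : f 0 = 0) (c : ℝ) (x : E) :
    ‖f x‖ₑ * ‖‖x‖ ^ (-(c + 1))‖ₑ ≤ ∫⁻ t in Set.Ioc (0 : ℝ) 1,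
      ENNReal.ofReal (t ^ c) * (‖fderiv ℝ f (t • x)‖ₑ * ‖‖t • x‖ ^ (-c)‖ₑ) := by
  rcases eq_or_ne x 0 with rfl | hx
  · simp [h0]
  have hmeas : Measurable fun t : ℝ => ‖x‖ₑ * ‖fderiv ℝ f (t • x)‖ₑ :=
    ((hf.continuous_fderiv one_ne_zero).comp
      (by fun_prop : Continuous fun t : ℝ => t • x)).enorm.measurable.const_mul _
  calc ‖f x‖ₑ * ‖‖x‖ ^ (-(c + 1))‖ₑ
      ≤ (∫⁻ t in Set.Ioc (0 : ℝ) 1, ‖x‖ₑ * ‖fderiv ℝ f (t • x)‖ₑ) * ‖‖x‖ ^ (-(c + 1))‖ₑ := by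
        gcongr
        simpa [h0] using enorm_sub_le_lintegral_enorm_fderiv hf 0 x
    _ = ∫⁻ t in Set.Ioc (0 : ℝ) 1, ‖x‖ₑ * ‖fderiv ℝ f (t • x)‖ₑ * ‖‖x‖ ^ (-(c + 1))‖ₑ :=
        (lintegral_mul_const _ hmeas).symm
    _ = _ := by
        refine setLIntegral_congr_fun measurableSet_Ioc fun t ht => ?_
        rw [mul_right_comm, enorm_mul_enorm_norm_rpow_neg c ht.1 hx, mul_assoc,
          mul_comm ‖‖t • x‖ ^ (-c)‖ₑ]

theorem setLIntegral_Ioc_zero_one_rpow {s : ℝ} (hs : -1 < s) :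
    ∫⁻ t in Set.Ioc (0 : ℝ) 1, ENNReal.ofReal (t ^ s) = ENNReal.ofReal (1 / (s + 1)) := by
  have hInt : IntegrableOn (fun t : ℝ => t ^ s) (Set.Ioc 0 1) :=
    (intervalIntegrable_iff_integrableOn_Ioc_of_le zero_le_one).1
      (intervalIntegral.intervalIntegrable_rpow' hs)
  rw [← ofReal_integral_eq_lintegral_ofReal hInt
    ((ae_restrict_mem measurableSet_Ioc).mono fun t ht => Real.rpow_nonneg ht.1.le _),
    ← intervalIntegral.integral_of_le zero_le_one, integral_rpow (Or.inl hs),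
    Real.one_rpow, Real.zero_rpow (by linarith), sub_zero]

variable [MeasurableSpace E] [BorelSpace E] [FiniteDimensional ℝ E]
  (μ : Measure E) [μ.IsAddHaarMeasure]

theorem lintegral_comp_smul_of_pos {g : E → ℝ≥0∞} (hg : Measurable g) {t : ℝ} (ht : 0 < t) :
    ∫⁻ x, g (t • x) ∂μ =
      ENNReal.ofReal (t ^ (-(Module.finrank ℝ E : ℝ))) * ∫⁻ x, g x ∂μ := by
  rw [← lintegral_map hg (by fun_prop), Measure.map_addHaar_smul μ ht.ne', lintegral_smul_measure,
    abs_of_pos (by positivity), Real.rpow_neg ht.le, Real.rpow_natCast, smul_eq_mul]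

theorem lintegral_enorm_mul_norm_rpow_neg_le (hf : ContDiff ℝ 1 f) (h0 : f 0 = 0)
    (hc : (Module.finrank ℝ E : ℝ) < c + 1) :
    ∫⁻ x, ‖f x‖ₑ * ‖‖x‖ ^ (-(c + 1))‖ₑ ∂μ ≤
      ENNReal.ofReal (1 / (c + 1 - Module.finrank ℝ E)) *
        ∫⁻ x, ‖fderiv ℝ f x‖ₑ * ‖‖x‖ ^ (-c)‖ₑ ∂μ := by
  set d := (Module.finrank ℝ E : ℝ)
  set g : E → ℝ≥0∞ := fun x => ‖fderiv ℝ f x‖ₑ * ‖‖x‖ ^ (-c)‖ₑ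
  have hg : Measurable g :=
    (hf.continuous_fderiv one_ne_zero).enorm.measurable.mul (by fun_prop)
  have hmeas : Measurable fun q : E × ℝ => ENNReal.ofReal (q.2 ^ c) * g (q.2 • q.1) :=
    .mul (by fun_prop) (hg.comp (by fun_prop))
  calc ∫⁻ x, ‖f x‖ₑ * ‖‖x‖ ^ (-(c + 1))‖ₑ ∂μ
      ≤ ∫⁻ x, (∫⁻ t in Set.Ioc (0 : ℝ) 1, ENNReal.ofReal (t ^ c) * g (t • x)) ∂μ :=
        lintegral_mono (enorm_mul_norm_rpow_neg_le_lintegral hf h0 c)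
    _ = ∫⁻ t in Set.Ioc (0 : ℝ) 1, ∫⁻ x, ENNReal.ofReal (t ^ c) * g (t • x) ∂μ :=
        lintegral_lintegral_swap hmeas.aemeasurable
    _ = ∫⁻ t in Set.Ioc (0 : ℝ) 1, ENNReal.ofReal (t ^ (c - d)) * ∫⁻ x, g x ∂μ := by
        refine setLIntegral_congr_fun measurableSet_Ioc fun t ht => ?_
        have hgt : Measurable fun x => g (t • x) := hg.comp (by fun_prop)
        rw [lintegral_const_mul _ hgt, lintegral_comp_smul_of_pos μ hg ht.1,
          ← mul_assoc, ← ENNReal.ofReal_mul (Real.rpow_nonneg ht.1.le _), ← Real.rpow_add ht.1,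
          sub_eq_add_neg]
    _ = _ := by
        rw [lintegral_mul_const _ (by fun_prop), setLIntegral_Ioc_zero_one_rpow (by linarith),
          sub_add_eq_add_sub]

end Hardy

section WeightedSobolev

variable {E F : Type*} [NormedAddCommGroup E] [InnerProductSpace ℝ E]
  [NormedAddCommGroup F] [NormedSpace ℝ F] {f : E → F} {c : ℝ}

theorem contDiff_norm_rpow_smul (hf : ContDiff ℝ 1 f) (h0 : 0 ∉ tsupport f) (a : ℝ) :
    ContDiff ℝ 1 fun x => ‖x‖ ^ a • f x := by
  refine contDiff_iff_contDiffAt.2 fun x => ?_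
  rcases eq_or_ne x 0 with rfl | hx
  · refine (contDiffAt_const (c := (0 : F))).congr_of_eventuallyEq ?_
    filter_upwards [notMem_tsupport_iff_eventuallyEq.1 h0] with y hy
    simp [hy]
  · exact ((contDiffAt_norm ℝ hx).rpow_const_of_ne (norm_ne_zero_iff.2 hx)).smul hf.contDiffAt

theorem enorm_fderiv_norm_rpow_le_of_ne_zero {x : E} (hx : x ≠ 0) (a : ℝ) :
    ‖fderiv ℝ (fun x : E => ‖x‖ ^ a) x‖ₑ ≤ ‖a‖ₑ * ‖‖x‖ ^ (a - 1)‖ₑ := by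
  have hnorm : DifferentiableAt ℝ (fun x : E => ‖x‖) x :=
    (contDiffAt_norm ℝ hx).differentiableAt one_ne_zero
  have hle : ‖fderiv ℝ (fun x : E => ‖x‖) x‖ₑ ≤ 1 := by
    rw [← ofReal_norm, ← ENNReal.ofReal_one]
    exact ENNReal.ofReal_le_ofReal (by
      simpa using norm_fderiv_le_of_lipschitz ℝ (x₀ := x) (lipschitzWith_one_norm (E := E)))
  rw [(hnorm.hasFDerivAt.rpow_const (.inl (norm_ne_zero_iff.2 hx))).fderiv, enorm_smul, enorm_mul]
  exact mul_le_of_le_one_right' hle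

theorem enorm_fderiv_norm_rpow_smul_le (hf : ContDiff ℝ 1 f) (h0 : 0 ∉ tsupport f) (hc : 0 ≤ c)
    (x : E) :
    ‖fderiv ℝ (fun x => ‖x‖ ^ (-c) • f x) x‖ₑ ≤
      ‖fderiv ℝ f x‖ₑ * ‖‖x‖ ^ (-c)‖ₑ +
        ENNReal.ofReal c * (‖f x‖ₑ * ‖‖x‖ ^ (-(c + 1))‖ₑ) := by
  rcases eq_or_ne x 0 with rfl | hx
  · have : (fun x => ‖x‖ ^ (-c) • f x) =ᶠ[nhds 0] fun _ => 0 := by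
      filter_upwards [notMem_tsupport_iff_eventuallyEq.1 h0] with y hy
      simp [hy]
    rw [this.fderiv_eq, fderiv_fun_const, Pi.zero_apply, ← ofReal_norm, norm_zero,
      ENNReal.ofReal_zero]
    exact zero_le
  have hweight : DifferentiableAt ℝ (fun x : E => ‖x‖ ^ (-c)) x :=
    ((contDiffAt_norm ℝ hx).rpow_const_of_ne (norm_ne_zero_iff.2 hx)).differentiableAt one_ne_zero
  have hfx := hf.differentiable one_ne_zero x
  rw [fderiv_fun_smul hweight hfx]
  refine (enorm_add_le (E := E →L[ℝ] F) _ _).trans (add_le_add (by rw [enorm_smul, mul_comm]) ?_)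
  have hsmul : ‖(fderiv ℝ (fun x : E => ‖x‖ ^ (-c)) x).smulRight (f x)‖ₑ =
      ‖fderiv ℝ (fun x : E => ‖x‖ ^ (-c)) x‖ₑ * ‖f x‖ₑ := by
    simp only [← ofReal_norm, ContinuousLinearMap.norm_smulRight_apply,
      ENNReal.ofReal_mul (norm_nonneg _)]
  rw [hsmul, mul_comm ‖f x‖ₑ, ← mul_assoc, neg_add, ← sub_eq_add_neg,
    ← Real.enorm_of_nonneg hc, ← enorm_neg c]
  gcongr
  exact enorm_fderiv_norm_rpow_le_of_ne_zero hx (-c)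

variable [MeasurableSpace E] [BorelSpace E] [FiniteDimensional ℝ E]
  (μ : Measure E) [μ.IsAddHaarMeasure]

theorem exists_eLpNorm_norm_rpow_smul_le_lintegral {p : ℝ≥0}
    (hp : NNReal.HolderConjugate (Module.finrank ℝ E) p) (hc : (Module.finrank ℝ E : ℝ) < c + 1) :
    ∃ C : ℝ≥0, ∀ f : E → F, ContDiff ℝ 1 f → HasCompactSupport f → 0 ∉ tsupport f →
      eLpNorm (fun x => ‖x‖ ^ (-c) • f x) p μ ≤
        C * ∫⁻ x, ‖fderiv ℝ f x‖ₑ * ‖‖x‖ ^ (-c)‖ₑ ∂μ := by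
  have hc0 : 0 ≤ c := by
    have : (1 : ℝ) < Module.finrank ℝ E := by exact_mod_cast hp.coe.lt
    linarith
  set d := (Module.finrank ℝ E : ℝ)
  set S := eLpNormLESNormFDerivOneConst μ p
  refine ⟨S * (1 + c.toNNReal * (1 / (c + 1 - d)).toNNReal), fun f hf hsupp h0 => ?_⟩
  have hfd : Measurable fun x => ‖fderiv ℝ f x‖ₑ * ‖‖x‖ ^ (-c)‖ₑ :=
    (hf.continuous_fderiv one_ne_zero).enorm.measurable.mul (by fun_prop)
  have hfm : Measurable fun x => ‖f x‖ₑ * ‖‖x‖ ^ (-(c + 1))‖ₑ :=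
    hf.continuous.enorm.measurable.mul (by fun_prop)
  calc eLpNorm (fun x => ‖x‖ ^ (-c) • f x) p μ
      ≤ S * ∫⁻ x, ‖fderiv ℝ (fun x => ‖x‖ ^ (-c) • f x) x‖ₑ ∂μ := by
        rw [← eLpNorm_one_eq_lintegral_enorm]
        exact eLpNorm_le_eLpNorm_fderiv_one μ (contDiff_norm_rpow_smul hf h0 _)
          hsupp.smul_left hp
    _ ≤ S * (∫⁻ x, ‖fderiv ℝ f x‖ₑ * ‖‖x‖ ^ (-c)‖ₑ ∂μ + ENNReal.ofReal c *
          ∫⁻ x, ‖f x‖ₑ * ‖‖x‖ ^ (-(c + 1))‖ₑ ∂μ) := by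
        rw [← lintegral_const_mul _ hfm, ← lintegral_add_left hfd]
        gcongr with x
        exact enorm_fderiv_norm_rpow_smul_le hf h0 hc0 x
    _ ≤ S * (∫⁻ x, ‖fderiv ℝ f x‖ₑ * ‖‖x‖ ^ (-c)‖ₑ ∂μ + ENNReal.ofReal c *
          (ENNReal.ofReal (1 / (c + 1 - d)) * ∫⁻ x, ‖fderiv ℝ f x‖ₑ * ‖‖x‖ ^ (-c)‖ₑ ∂μ)) := by
        gcongr
        exact lintegral_enorm_mul_norm_rpow_neg_le μ hf (image_eq_zero_of_notMem_tsupport h0) hc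
    _ = _ := by
        push_cast
        simp only [ENNReal.ofReal]
        ring

end WeightedSobolev

/-- Lebesgue measure on the exterior of the unit ball. -/
abbrev exteriorVolume (N : ℕ) : Measure (EuclideanSpace ℝ (Fin N)) :=
  volume.restrict (unitBallExterior N)

/-- The model weighted measure `|x|^(-γ) dx` on the exterior of the unit ball. -/
def powerMeasure (N : ℕ) (γ : ℝ) : Measure (EuclideanSpace ℝ (Fin N)) :=
  weightedMeasure N fun x => ‖x‖ ^ (-γ)

section PowerMeasure

variable {N : ℕ} {γ : ℝ}

theorem one_lt_norm_ae_exteriorVolume : ∀ᵐ x ∂exteriorVolume N, 1 < ‖x‖ :=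
  ae_restrict_mem (unitBallExterior N).isOpen.measurableSet

theorem isFiniteMeasure_powerMeasure (hγ : (N : ℝ) < γ) : IsFiniteMeasure (powerMeasure N γ) := by
  have hγ0 : 0 ≤ γ := N.cast_nonneg.trans hγ.le
  have hInt : Integrable (fun x : EuclideanSpace ℝ (Fin N) => 2 ^ γ * (1 + ‖x‖) ^ (-γ)) :=
    (integrable_one_add_norm (by simpa using hγ)).const_mul _
  refine isFiniteMeasure_withDensity_ofReal
    (hInt.restrict.hasFiniteIntegral.mono ?_)
  filter_upwards [one_lt_norm_ae_exteriorVolume] with x hx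
  rw [Real.norm_of_nonneg (by positivity), Real.norm_of_nonneg (by positivity),
    Real.rpow_neg (by positivity), Real.rpow_neg (by positivity), ← div_eq_mul_inv,
    ← Real.div_rpow (by positivity) (by positivity), ← Real.inv_rpow (by positivity)]
  refine Real.rpow_le_rpow (by positivity) ?_ hγ0
  rw [inv_le_comm₀ (by positivity) (by positivity), inv_div]
  linarith

theorem eLpNorm_powerMeasure (f : EuclideanSpace ℝ (Fin N) → ℝ) {p : ℝ≥0∞} (hp0 : p ≠ 0)
    (hp : p ≠ ∞) :
    eLpNorm f p (powerMeasure N γ) =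
      eLpNorm (fun x => ‖x‖ ^ (-(γ / p.toReal)) • f x) p (exteriorVolume N) := by
  have hpos : 0 < p.toReal := ENNReal.toReal_pos hp0 hp
  rw [eLpNorm_eq_lintegral_rpow_enorm_toReal hp0 hp, eLpNorm_eq_lintegral_rpow_enorm_toReal hp0 hp,
    powerMeasure, weightedMeasure, lintegral_withDensity_eq_lintegral_mul_non_measurable _
      (by fun_prop) (by simp)]
  congr 2 with x
  rw [Pi.mul_apply, enorm_smul, ENNReal.mul_rpow_of_nonneg _ _ hpos.le,
    Real.enorm_of_nonneg (Real.rpow_nonneg (norm_nonneg x) (-(γ / p.toReal))),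
    ENNReal.ofReal_rpow_of_nonneg (by positivity) hpos.le,
    ← Real.rpow_mul (norm_nonneg x), neg_mul, div_mul_cancel₀ _ hpos.ne']

end PowerMeasure

theorem eLpNorm_pow {α R : Type*} {m : MeasurableSpace α} {μ : Measure α} [NormedRing R]
    [NormMulClass R] [NormOneClass R] (f : α → R) {k : ℕ} (hk : k ≠ 0) (p : ℝ≥0∞) :
    eLpNorm (fun x => f x ^ k) p μ = eLpNorm f (k * p) μ ^ k := by
  have := eLpNorm_enorm_rpow (μ := μ) (p := p) f (q := k) (by positivity)
  simpa only [ENNReal.rpow_natCast, ← enorm_pow, eLpNorm_enorm, ENNReal.ofReal_natCast, mul_comm p]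
    using this

theorem exists_eLpNorm_le_mul_of_exponent_le {α F : Type*} [MeasurableSpace α]
    [NormedAddCommGroup F] (μ : Measure α) [IsFiniteMeasure μ] {p q : ℝ≥0∞} (hpq : p ≤ q) :
    ∃ C : ℝ≥0, ∀ f : α → F, AEStronglyMeasurable f μ → eLpNorm f p μ ≤ C * eLpNorm f q μ := by
  rcases eq_or_ne p 0 with rfl | hp0
  · exact ⟨0, fun f _ => by simp⟩
  have hexp : 0 ≤ 1 / p.toReal - 1 / q.toReal := by
    rcases eq_or_ne q ∞ with rfl | hq
    · simp
    · exact sub_nonneg.2 (one_div_le_one_div_of_le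
        (ENNReal.toReal_pos hp0 (ne_top_of_le_ne_top hq hpq)) (ENNReal.toReal_mono hq hpq))
  refine ⟨(μ Set.univ ^ (1 / p.toReal - 1 / q.toReal)).toNNReal, fun f hf => ?_⟩
  rw [ENNReal.coe_toNNReal (ENNReal.rpow_ne_top_of_nonneg hexp (measure_ne_top _ _)), mul_comm]
  exact eLpNorm_le_eLpNorm_mul_rpow_measure_univ hpq hf

namespace ExteriorTest

variable {N : ℕ} {γ : ℝ}

theorem zero_notMem_tsupport (φ : ExteriorTest N) : 0 ∉ tsupport φ := fun h => by
  have : (1 : ℝ) < ‖(0 : EuclideanSpace ℝ (Fin N))‖ := φ.tsupport_subset h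
  norm_num at this

theorem continuous (φ : ExteriorTest N) : Continuous φ := φ.contDiff.continuous

theorem enorm_grad (φ : ExteriorTest N) (x : EuclideanSpace ℝ (Fin N)) :
    ‖∇ φ x‖ₑ = ‖fderiv ℝ φ x‖ₑ := by
  rw [grad_eq, ← ofReal_norm, LinearIsometryEquiv.norm_map, ofReal_norm]

theorem enorm_eq_eLpNorm [Fact (2 ≤ N)] (φ : ExteriorTest N) :
    ‖φ‖ₑ = eLpNorm (∇ φ) N (exteriorVolume N) := by
  rw [← ofReal_norm, norm_eq_eLpNorm dim_ne_zero,
    ENNReal.ofReal_toReal (φ.memLp_grad N).eLpNorm_ne_top]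

theorem enorm_fderiv_pow (φ : ExteriorTest N) (s : ℕ) (x : EuclideanSpace ℝ (Fin N)) :
    ‖fderiv ℝ (fun x => φ x ^ (s + 1)) x‖ₑ = (s + 1 : ℕ) * (‖φ x ^ s‖ₑ * ‖∇ φ x‖ₑ) := by
  rw [((φ.differentiable x).hasFDerivAt.pow (s + 1)).fderiv, enorm_smul, enorm_grad,
    nsmul_eq_mul, enorm_mul, mul_assoc, add_tsub_cancel_right, Real.enorm_natCast]

theorem grad_eq_zero_of_notMem (φ : ExteriorTest N) {x : EuclideanSpace ℝ (Fin N)}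
    (hx : x ∉ unitBallExterior N) : ∇ φ x = 0 := by
  have hz : fderiv ℝ φ x = 0 := image_eq_zero_of_notMem_tsupport
    fun hx' => hx (φ.tsupport_subset (tsupport_fderiv_subset ℝ hx'))
  rw [grad_eq, hz, map_zero]

theorem lintegral_enorm_fderiv_pow_mul (φ : ExteriorTest N) (s : ℕ) (a : ℝ) :
    ∫⁻ x, ‖fderiv ℝ (fun x => φ x ^ (s + 1)) x‖ₑ * ‖‖x‖ ^ a‖ₑ =
      (s + 1 : ℕ) * eLpNorm (fun x => (‖x‖ ^ a • φ x ^ s) • ∇ φ x) 1 (exteriorVolume N) := by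
  have hmeas : Measurable fun x => ‖(‖x‖ ^ a • φ x ^ s) • ∇ φ x‖ₑ :=
    (Measurable.smul ((measurable_norm.pow_const a).smul (φ.continuous.pow s).measurable)
      φ.continuous_grad.measurable).enorm
  rw [eLpNorm_one_eq_lintegral_enorm, ← lintegral_const_mul _ hmeas,
    ← lintegral_indicator (unitBallExterior N).isOpen.measurableSet]
  refine lintegral_congr fun x => ?_
  rw [enorm_fderiv_pow]
  by_cases hx : x ∈ unitBallExterior N
  · rw [Set.indicator_of_mem hx, enorm_smul, enorm_smul]
    ring
  · rw [Set.indicator_of_notMem hx, φ.grad_eq_zero_of_notMem hx, enorm_zero, mul_zero, mul_zero,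
      zero_mul]

variable [Fact (2 ≤ N)]

theorem exists_holderConjugate_dim : ∃ p : ℝ≥0, NNReal.HolderConjugate N p := by
  have hN : 2 ≤ N := Fact.out
  exact ⟨_, NNReal.HolderConjugate.conjExponent (by exact_mod_cast hN)⟩

theorem exists_eLpNorm_pow_succ_le {p : ℝ≥0} (hp : NNReal.HolderConjugate N p)
    (hγ : (N : ℝ) < γ) (s : ℕ) :
    ∃ C : ℝ≥0, ∀ φ : ExteriorTest N,
      eLpNorm (fun x => φ x ^ (s + 1)) p (powerMeasure N γ) ≤
        C * (eLpNorm (fun x => φ x ^ s) p (powerMeasure N γ) * ‖φ‖ₑ) := by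
  have hp0 : (p : ℝ≥0∞) ≠ 0 := by exact_mod_cast hp.symm.ne_zero
  have hc : (Module.finrank ℝ (EuclideanSpace ℝ (Fin N)) : ℝ) < γ / p + 1 := by
    have hp' : 0 < (p : ℝ) := by exact_mod_cast hp.symm.pos
    have hNp : (N : ℝ) * p = N + p := by simpa using hp.coe.mul_eq_add
    rw [finrank_euclideanSpace_fin, ← sub_lt_iff_lt_add, lt_div_iff₀ hp']
    linarith
  obtain ⟨C, hC⟩ := exists_eLpNorm_norm_rpow_smul_le_lintegral (F := ℝ)
    (volume : Measure (EuclideanSpace ℝ (Fin N))) (by simpa using hp) hc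
  refine ⟨C * (s + 1 : ℕ), fun φ => ?_⟩
  have hsupp : tsupport (fun x => φ x ^ (s + 1)) ⊆ tsupport φ :=
    (congrArg closure (Function.support_pow φ s.succ_ne_zero)).le
  have hholder : eLpNorm (fun x => (‖x‖ ^ (-(γ / p)) • φ x ^ s) • ∇ φ x) 1 (exteriorVolume N) ≤
      eLpNorm (fun x => φ x ^ s) p (powerMeasure N γ) * ‖φ‖ₑ := by
    have : ENNReal.HolderTriple p N 1 := by simpa using hp.symm.coe_ennreal
    rw [eLpNorm_powerMeasure _ hp0 ENNReal.coe_ne_top, enorm_eq_eLpNorm]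
    exact eLpNorm_smul_le_mul_eLpNorm (𝕜 := ℝ) φ.continuous_grad.aestronglyMeasurable
      (Measurable.smul (measurable_norm.pow_const (-(γ / p)))
        (φ.continuous.pow s).measurable).aestronglyMeasurable
  calc
    _ = eLpNorm (fun x => ‖x‖ ^ (-(γ / p)) • φ x ^ (s + 1)) p (exteriorVolume N) :=
      eLpNorm_powerMeasure _ hp0 ENNReal.coe_ne_top
    _ ≤ eLpNorm (fun x => ‖x‖ ^ (-(γ / p)) • φ x ^ (s + 1)) p volume :=
      eLpNorm_mono_measure _ Measure.restrict_le_self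
    _ ≤ C * ∫⁻ x, ‖fderiv ℝ (fun x => φ x ^ (s + 1)) x‖ₑ * ‖‖x‖ ^ (-(γ / p))‖ₑ :=
      hC _ ((φ.contDiff.of_le (by simp)).pow _)
        (φ.hasCompactSupport.mono' (subset_closure.trans hsupp))
        fun h => φ.zero_notMem_tsupport (hsupp h)
    _ ≤ _ := by
      rw [lintegral_enorm_fderiv_pow_mul, ENNReal.coe_mul, ENNReal.coe_natCast, mul_assoc]
      gcongr

theorem exists_eLpNorm_pow_le {p : ℝ≥0} (hp : NNReal.HolderConjugate N p)
    (hγ : (N : ℝ) < γ) (s : ℕ) :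
    ∃ C : ℝ≥0, ∀ φ : ExteriorTest N,
      eLpNorm (fun x => φ x ^ s) p (powerMeasure N γ) ≤ C * ‖φ‖ₑ ^ s := by
  induction s with
  | zero =>
    have := isFiniteMeasure_powerMeasure hγ
    have hfin : eLpNorm (fun _ => (1 : ℝ)) p (powerMeasure N γ) < ∞ := (memLp_const 1).2
    exact ⟨_, fun φ => by simpa using (ENNReal.coe_toNNReal hfin.ne).ge⟩
  | succ s ih =>
    obtain ⟨C₁, hC₁⟩ := ih
    obtain ⟨C₂, hC₂⟩ := exists_eLpNorm_pow_succ_le hp hγ s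
    refine ⟨C₂ * C₁, fun φ => (hC₂ φ).trans ?_⟩
    grw [hC₁ φ]
    rw [ENNReal.coe_mul, pow_succ, mul_assoc, mul_assoc]

theorem exists_eLpNorm_powerMeasure_le (hγ : (N : ℝ) < γ) {r : ℝ≥0∞} (hr : r ≠ ∞) :
    ∃ C : ℝ≥0, ∀ φ : ExteriorTest N, eLpNorm φ r (powerMeasure N γ) ≤ C * ‖φ‖ₑ := by
  have := isFiniteMeasure_powerMeasure hγ
  obtain ⟨p, hp⟩ := exists_holderConjugate_dim (N := N)
  obtain ⟨k, hk⟩ := exists_nat_gt r.toNNReal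
  have hk0 : 0 < k := by exact_mod_cast (zero_le).trans_lt hk
  have hrq : r ≤ (k * p : ℝ≥0) := by
    rw [← ENNReal.coe_toNNReal hr]
    exact ENNReal.coe_le_coe.2 (hk.le.trans (le_mul_of_one_le_right (by positivity) hp.symm.lt.le))
  obtain ⟨C, hC⟩ := exists_eLpNorm_pow_le hp hγ k
  have hA : ∀ φ : ExteriorTest N, eLpNorm φ (k * p : ℝ≥0) (powerMeasure N γ) ≤
      (C ^ (k : ℝ)⁻¹ : ℝ≥0) * ‖φ‖ₑ := fun φ => by
    refine (ENNReal.pow_le_pow_left_iff hk0.ne').1 ?_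
    calc
      _ = eLpNorm (fun x => φ x ^ k) p (powerMeasure N γ) := by
        rw [eLpNorm_pow _ hk0.ne', ENNReal.coe_mul, ENNReal.coe_natCast]
      _ ≤ C * ‖φ‖ₑ ^ k := hC φ
      _ = _ := by
        rw [mul_pow, ← ENNReal.coe_pow, NNReal.rpow_inv_natCast_pow _ hk0.ne']
  obtain ⟨B, hB⟩ := exists_eLpNorm_le_mul_of_exponent_le (F := ℝ) (powerMeasure N γ) hrq
  refine ⟨B * C ^ (k : ℝ)⁻¹, fun φ => (hB φ φ.continuous.aestronglyMeasurable).trans ?_⟩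
  grw [hA φ]
  rw [ENNReal.coe_mul, mul_assoc]

end ExteriorTest

section CompactOperator

variable {X Y : Type*} [NormedAddCommGroup X] [NormedSpace ℝ X]
  [NormedAddCommGroup Y] [NormedSpace ℝ Y]

theorem isCompactOperator_of_forall_exists_norm_le [CompleteSpace Y] {T : X →L[ℝ] Y}
    (h : ∀ ε > 0, ∃ (Z : Type) (_ : NormedAddCommGroup Z) (_ : NormedSpace ℝ Z) (S : X →L[ℝ] Z),
      IsCompactOperator S ∧ ∃ δ > 0, ∀ x, ‖x‖ ≤ 1 → ‖S x‖ ≤ δ → ‖T x‖ ≤ ε) :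
    IsCompactOperator T := by
  refine (isCompactOperator_iff_isCompact_closure_image_ball T.toLinearMap (by positivity :
    0 < (1 : ℝ) / 2)).2 ((TotallyBounded.closure ?_).isCompact_of_isClosed isClosed_closure)
  refine Metric.totallyBounded_iff.2 fun ε hε => ?_
  obtain ⟨Z, _, _, S, hS, δ, hδ, hST⟩ := h (ε / 2) (half_pos hε)
  have hSb : TotallyBounded (S '' Metric.ball 0 (1 / 2)) :=
    (hS.isCompact_closure_image_ball (1 / 2)).totallyBounded.subset subset_closure
  obtain ⟨_, hts, htf, hcov⟩ := Metric.finite_approx_of_totallyBounded hSb δ hδ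
  obtain ⟨u, hu, huf, rfl⟩ := htf.exists_subset_finite_image_eq hts
  refine ⟨T '' u, huf.image _, ?_⟩
  rintro _ ⟨x, hx, rfl⟩
  obtain ⟨_, ⟨y, hy, rfl⟩, hxy⟩ := Set.mem_iUnion₂.1 (hcov (Set.mem_image_of_mem S hx))
  refine Set.mem_iUnion₂.2 ⟨T y, Set.mem_image_of_mem T hy, ?_⟩
  rw [mem_ball_iff_norm, ← map_sub] at hxy
  have hnorm : ‖x - y‖ ≤ 1 := by
    have hx' := mem_ball_zero_iff.1 hx
    have hy' := mem_ball_zero_iff.1 (hu hy)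
    linarith [norm_sub_le x y]
  refine mem_ball_iff_norm.2 ?_
  rw [ContinuousLinearMap.coe_coe, ← map_sub]
  linarith [hST (x - y) hnorm hxy.le]

theorem isCompactOperator_of_comp_toComplL {T : UniformSpace.Completion X →L[ℝ] Y}
    (h : IsCompactOperator (T.comp UniformSpace.Completion.toComplL : X →L[ℝ] Y)) :
    IsCompactOperator T := by
  refine (isCompactOperator_iff_isCompact_closure_image_ball T.toLinearMap one_pos).2
    ((h.isCompact_closure_image_ball 1).of_isClosed_subset isClosed_closure
      (closure_minimal ?_ isClosed_closure))
  rintro _ ⟨x, hx, rfl⟩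
  have hx' : x ∈ closure (Metric.ball 0 1 ∩ Set.range ((↑) : X → UniformSpace.Completion X)) :=
    UniformSpace.Completion.denseRange_coe.open_subset_closure_inter Metric.isOpen_ball hx
  refine closure_mono ?_ (image_closure_subset_closure_image T.continuous
    (Set.mem_image_of_mem T hx'))
  rintro _ ⟨_, ⟨hmem, y, rfl⟩, rfl⟩
  refine Set.mem_image_of_mem (T.comp UniformSpace.Completion.toComplL) ?_
  rwa [mem_ball_zero_iff, UniformSpace.Completion.norm_coe, ← mem_ball_zero_iff] at hmem

end CompactOperator

section PowerMeasure

variable {N : ℕ} {γ γ' R : ℝ}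

theorem powerMeasure_le_volume (hγ : 0 ≤ γ) : powerMeasure N γ ≤ volume := by
  calc
    powerMeasure N γ ≤ (exteriorVolume N).withDensity 1 := by
      refine withDensity_mono ?_
      filter_upwards [one_lt_norm_ae_exteriorVolume] with x hx
      exact ENNReal.ofReal_le_one.2
        (Real.rpow_le_one_of_one_le_of_nonpos hx.le (neg_nonpos.2 hγ))
    _ ≤ volume := by
      rw [withDensity_one]
      exact Measure.restrict_le_self

theorem powerMeasure_restrict_compl_closedBall_le (hγ : γ' ≤ γ) (hR : 0 < R) :
    (powerMeasure N γ).restrict (Metric.closedBall 0 R)ᶜ ≤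
      ENNReal.ofReal (R ^ (γ' - γ)) • powerMeasure N γ' := by
  have hs : MeasurableSet (Metric.closedBall (0 : EuclideanSpace ℝ (Fin N)) R)ᶜ :=
    measurableSet_closedBall.compl
  rw [powerMeasure, powerMeasure, weightedMeasure, weightedMeasure, restrict_withDensity hs,
    ← withDensity_smul _ (by fun_prop)]
  calc
    _ ≤ ((exteriorVolume N).restrict (Metric.closedBall 0 R)ᶜ).withDensity
        (ENNReal.ofReal (R ^ (γ' - γ)) • fun x => ENNReal.ofReal (‖x‖ ^ (-γ'))) := by
      refine withDensity_mono ?_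
      filter_upwards [ae_restrict_mem hs] with x hx
      have hRx : R < ‖x‖ := by simpa using hx
      have hx0 : 0 < ‖x‖ := hR.trans hRx
      rw [Pi.smul_apply, smul_eq_mul, ← ENNReal.ofReal_mul (by positivity)]
      refine ENNReal.ofReal_le_ofReal ?_
      calc
        ‖x‖ ^ (-γ) = ‖x‖ ^ (γ' - γ) * ‖x‖ ^ (-γ') := by
          rw [← Real.rpow_add hx0]
          congr 1
          ring
        _ ≤ R ^ (γ' - γ) * ‖x‖ ^ (-γ') := by
          gcongr ?_ * _
          exact Real.rpow_le_rpow_of_nonpos hR hRx.le (sub_nonpos.2 hγ)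
    _ ≤ _ := by
      rw [← restrict_withDensity hs]
      exact Measure.restrict_le_self

end PowerMeasure

namespace ExteriorTest

variable {N : ℕ} {γ : ℝ}

theorem eLpNorm_fderiv_eq_enorm [Fact (2 ≤ N)] (φ : ExteriorTest N) :
    eLpNorm (fderiv ℝ φ) N volume = ‖φ‖ₑ := by
  rw [enorm_eq_eLpNorm, eLpNorm_congr_enorm_ae (.of_forall fun x => (φ.enorm_grad x).symm)]
  refine (eLpNorm_restrict_eq_of_support_subset fun x hx => ?_).symm
  by_contra hxU
  exact hx (φ.grad_eq_zero_of_notMem hxU)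

theorem ballAverage_zero (φ : ExteriorTest N) {ρ : ℝ} (hρ1 : ρ ≤ 1) :
    ballAverage volume ρ φ 0 = 0 := by
  refine integral_eq_zero_of_ae ?_
  filter_upwards [ProbabilityTheory.ae_cond_mem measurableSet_ball] with h hh
  refine image_eq_zero_of_notMem_tsupport fun hmem => ?_
  have : 1 < ‖0 + h‖ := φ.tsupport_subset hmem
  rw [zero_add] at this
  linarith [mem_ball_zero_iff.1 hh]

variable [Fact (2 ≤ N)]

theorem one_le_natCast_dim : 1 ≤ (N : ℝ≥0∞) := by
  have : 2 ≤ N := Fact.out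
  exact_mod_cast one_le_two.trans this

theorem exists_enorm_ballAverage_sub_le {ρ : ℝ} (hρ : 0 < ρ) :
    ∃ C : ℝ≥0, ∀ (φ : ExteriorTest N) x y,
      ‖ballAverage volume ρ φ x - ballAverage volume ρ φ y‖ₑ ≤ C * ‖φ‖ₑ * ‖x - y‖ₑ := by
  set V := volume (Metric.ball (0 : EuclideanSpace ℝ (Fin N)) ρ)
  have hV : V⁻¹ ^ (1 / (N : ℝ≥0∞)).toReal ≠ ∞ :=
    ENNReal.rpow_ne_top_of_nonneg ENNReal.toReal_nonneg
      (ENNReal.inv_ne_top.2 (Metric.measure_ball_pos volume 0 hρ).ne')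
  refine ⟨(V⁻¹ ^ (1 / (N : ℝ≥0∞)).toReal).toNNReal, fun φ x y => ?_⟩
  rw [ENNReal.coe_toNNReal hV, ← eLpNorm_fderiv_eq_enorm]
  exact enorm_ballAverage_sub_le volume (φ.contDiff.of_le (by simp)) one_le_natCast_dim
    (ENNReal.natCast_ne_top N) hρ x y

theorem continuous_ballAverage {ρ : ℝ} (hρ : 0 < ρ) (φ : ExteriorTest N) :
    Continuous (ballAverage volume ρ φ) := by
  obtain ⟨C, hC⟩ := exists_enorm_ballAverage_sub_le (N := N) hρ
  refine LipschitzWith.continuous (K := C * ‖φ‖₊) fun x y => ?_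
  rw [edist_eq_enorm_sub, edist_eq_enorm_sub, ENNReal.coe_mul]
  exact hC φ x y

/-- The average of a test function over the ball of radius `ρ ≤ 1` around `x`, as a bounded
functional. -/
def ballAverageCLM {ρ : ℝ} (hρ : 0 < ρ) (hρ1 : ρ ≤ 1) (x : EuclideanSpace ℝ (Fin N)) :
    ExteriorTest N →L[ℝ] ℝ :=
  LinearMap.mkContinuousOfExistsBound
    { toFun φ := ballAverage volume ρ φ x
      map_add' φ ψ := integral_add (integrable_comp_add_cond_ball volume hρ φ.continuous x)
        (integrable_comp_add_cond_ball volume hρ ψ.continuous x)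
      map_smul' c φ := integral_const_mul c _ } <| by
    obtain ⟨C, hC⟩ := exists_enorm_ballAverage_sub_le (N := N) hρ
    refine ⟨C * ‖x‖, fun φ => ?_⟩
    have h := hC φ x 0
    rw [φ.ballAverage_zero hρ1, sub_zero, sub_zero, mul_right_comm] at h
    simp only [enorm_eq_nnnorm, ← ENNReal.coe_mul, ENNReal.coe_le_coe] at h
    exact h

theorem exists_finset_enorm_ballAverage_le {ρ : ℝ} (hρ : 0 < ρ) (R : ℝ) {ε : ℝ≥0} (hε : 0 < ε) :
    ∃ t : Finset (EuclideanSpace ℝ (Fin N)), ∀ φ : ExteriorTest N, ∀ x ∈ Metric.closedBall 0 R,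
      ∃ y ∈ t, ‖ballAverage volume ρ φ x‖ₑ ≤ ‖ballAverage volume ρ φ y‖ₑ + ε * ‖φ‖ₑ := by
  obtain ⟨C, hC⟩ := exists_enorm_ballAverage_sub_le (N := N) hρ
  have hη : 0 < ε / (C + 1) := by positivity
  obtain ⟨t, -, ht, hcov⟩ := Metric.finite_approx_of_totallyBounded
    (isCompact_closedBall (0 : EuclideanSpace ℝ (Fin N)) R).totallyBounded (ε / (C + 1)) hη
  refine ⟨ht.toFinset, fun φ x hx => ?_⟩
  obtain ⟨y, hy, hxy⟩ := Set.mem_iUnion₂.1 (hcov hx)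
  have hdist : ‖x - y‖₊ ≤ ε / (C + 1) := (mem_ball_iff_norm.1 hxy).le
  have hCε : C * ‖x - y‖₊ ≤ ε := by
    grw [hdist, ← mul_div_assoc, div_le_iff₀ (by positivity), mul_comm]
    gcongr
    exact le_self_add
  refine ⟨y, ht.mem_toFinset.2 hy, ?_⟩
  calc
    ‖ballAverage volume ρ φ x‖ₑ ≤ ‖ballAverage volume ρ φ y‖ₑ +
        ‖ballAverage volume ρ φ x - ballAverage volume ρ φ y‖ₑ := by
      rw [← enorm_neg (_ - _), neg_sub]
      simpa only [sub_sub_cancel] using enorm_sub_le (a := ballAverage volume ρ φ y)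
        (b := ballAverage volume ρ φ y - ballAverage volume ρ φ x)
    _ ≤ _ := by
      grw [hC φ x y, mul_right_comm, enorm_eq_nnnorm (x - y), ← ENNReal.coe_mul, hCε]

theorem exists_eLpNorm_ballAverage_restrict_closedBall_le {ρ : ℝ} (hρ : 0 < ρ) (hρ1 : ρ ≤ 1)
    (R : ℝ) {ε : ℝ≥0} (hε : 0 < ε) :
    ∃ (t : Finset (EuclideanSpace ℝ (Fin N))) (S : ExteriorTest N →L[ℝ] (t → ℝ)) (C : ℝ≥0),
      ∀ φ : ExteriorTest N,
        eLpNorm (ballAverage volume ρ φ) N (volume.restrict (Metric.closedBall 0 R)) ≤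
          ε * ‖φ‖ₑ + C * ‖S φ‖ₑ := by
  set B : Set (EuclideanSpace ℝ (Fin N)) := Metric.closedBall 0 R
  have hWtop : volume B ^ (N : ℝ≥0∞).toReal⁻¹ ≠ ∞ :=
    ENNReal.rpow_ne_top_of_nonneg (by positivity) measure_closedBall_lt_top.ne
  obtain ⟨W, hW⟩ : ∃ W : ℝ≥0, (W : ℝ≥0∞) = volume B ^ (N : ℝ≥0∞).toReal⁻¹ :=
    ⟨_, ENNReal.coe_toNNReal hWtop⟩
  have hεW : ε / (W + 1) * W ≤ ε := by
    rw [div_mul_eq_mul_div, div_le_iff₀ (by positivity)]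
    gcongr
    exact le_self_add
  obtain ⟨t, ht⟩ := exists_finset_enorm_ballAverage_le (N := N) hρ R
    (by positivity : 0 < ε / (W + 1))
  set S : ExteriorTest N →L[ℝ] (t → ℝ) := .pi fun y => ballAverageCLM hρ hρ1 y
  refine ⟨t, S, W, fun φ => ?_⟩
  have hbound : ∀ x ∈ B, ‖ballAverage volume ρ φ x‖ₑ ≤
      (ε / (W + 1) : ℝ≥0) * ‖φ‖ₑ + ‖S φ‖ₑ := fun x hx => by
    obtain ⟨y, hy, hxy⟩ := ht φ x hx
    grw [hxy, add_comm]
    gcongr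
    exact ENNReal.coe_le_coe.2 (nnnorm_le_pi_nnnorm (S φ) ⟨y, hy⟩)
  calc
    _ ≤ ((ε / (W + 1) : ℝ≥0) * ‖φ‖ₑ + ‖S φ‖ₑ) * W := by
      refine (eLpNorm_le_of_ae_enorm_bound
        ((ae_restrict_mem measurableSet_closedBall).mono hbound)).trans_eq ?_
      rw [Measure.restrict_apply_univ, smul_eq_mul, hW]
    _ ≤ ε * ‖φ‖ₑ + W * ‖S φ‖ₑ := by
      rw [add_mul, mul_right_comm, ← ENNReal.coe_mul, mul_comm (‖S φ‖ₑ)]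
      gcongr

theorem exists_eLpNorm_restrict_closedBall_le (R : ℝ) {ε : ℝ≥0} (hε : 0 < ε) :
    ∃ (t : Finset (EuclideanSpace ℝ (Fin N))) (S : ExteriorTest N →L[ℝ] (t → ℝ)) (C : ℝ≥0),
      ∀ φ : ExteriorTest N, eLpNorm φ N (volume.restrict (Metric.closedBall 0 R)) ≤
        ε * ‖φ‖ₑ + C * ‖S φ‖ₑ := by
  obtain ⟨ρ, hρ, hρ'⟩ : ∃ ρ : ℝ≥0, 0 < ρ ∧ ρ ≤ min 1 (ε / 2) := ⟨_, by positivity, le_rfl⟩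
  obtain ⟨hρ1, hρε⟩ := le_min_iff.1 hρ'
  obtain ⟨t, S, C, hS⟩ := exists_eLpNorm_ballAverage_restrict_closedBall_le (N := N) hρ hρ1 R
    (half_pos hε)
  refine ⟨t, S, C, fun φ => ?_⟩
  have hφ : ContDiff ℝ 1 φ := φ.contDiff.of_le (by simp)
  have hA := continuous_ballAverage hρ φ
  calc
    _ = eLpNorm ((fun x => φ x - ballAverage volume ρ φ x) + ballAverage volume ρ φ) N
        (volume.restrict (Metric.closedBall 0 R)) := by
      congr 1
      ext x
      simp
    _ ≤ eLpNorm (fun x => φ x - ballAverage volume ρ φ x) N volume +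
        eLpNorm (ballAverage volume ρ φ) N (volume.restrict (Metric.closedBall 0 R)) := by
      refine (eLpNorm_add_le (φ.continuous.sub hA).aestronglyMeasurable
        hA.aestronglyMeasurable one_le_natCast_dim).trans ?_
      exact add_le_add (eLpNorm_mono_measure _ Measure.restrict_le_self) le_rfl
    _ ≤ ρ * ‖φ‖ₑ + ((ε / 2 : ℝ≥0) * ‖φ‖ₑ + C * ‖S φ‖ₑ) := by
      refine add_le_add ?_ (hS φ)
      rw [← eLpNorm_fderiv_eq_enorm, ← ENNReal.ofReal_coe_nnreal]
      exact eLpNorm_sub_ballAverage_le volume hφ one_le_natCast_dim (ENNReal.natCast_ne_top N) hρ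
    _ ≤ _ := by
      grw [hρε]
      rw [← add_assoc, ← add_mul, ← ENNReal.coe_add, add_halves]

theorem exists_eLpNorm_restrict_compl_closedBall_le (hγ : (N : ℝ) < γ) {ε : ℝ≥0} (hε : 0 < ε) :
    ∃ R, ∀ φ : ExteriorTest N,
      eLpNorm φ N ((powerMeasure N γ).restrict (Metric.closedBall 0 R)ᶜ) ≤ ε * ‖φ‖ₑ := by
  obtain ⟨γ', hNγ', hγ'⟩ := exists_between hγ
  obtain ⟨C, hC⟩ := exists_eLpNorm_powerMeasure_le hNγ' (ENNReal.natCast_ne_top N)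
  have hlim : Filter.Tendsto (fun R : ℝ => ENNReal.ofReal (R ^ (γ' - γ)) ^
      (1 / (N : ℝ≥0∞)).toReal * C) Filter.atTop (nhds 0) := by
    have hrpow : Filter.Tendsto (fun R : ℝ => R ^ (γ' - γ)) Filter.atTop (nhds 0) := by
      simpa only [neg_sub] using tendsto_rpow_neg_atTop (sub_pos.2 hγ')
    have hN : 0 < (1 / (N : ℝ≥0∞)).toReal :=
      ENNReal.toReal_pos (by simp) (by simp [dim_ne_zero])
    have h := ENNReal.Tendsto.mul_const (((ENNReal.continuous_rpow_const
      (y := (1 / (N : ℝ≥0∞)).toReal)).tendsto _).comp (ENNReal.tendsto_ofReal hrpow))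
      (.inr ENNReal.coe_ne_top : _ ∨ (C : ℝ≥0∞) ≠ ∞)
    simpa only [ENNReal.ofReal_zero, ENNReal.zero_rpow_of_pos hN, zero_mul,
      Function.comp_apply] using h
  obtain ⟨R, hR, hR0⟩ := ((hlim.eventually_le_const (ENNReal.coe_pos.2 hε)).and
    (Filter.eventually_gt_atTop 0)).exists
  refine ⟨R, fun φ => ?_⟩
  calc
    _ ≤ ENNReal.ofReal (R ^ (γ' - γ)) ^ (1 / (N : ℝ≥0∞)).toReal * eLpNorm φ N (powerMeasure N γ') :=
      eLpNorm_le_of_measure_le_smul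
        (powerMeasure_restrict_compl_closedBall_le hγ'.le hR0)
    _ ≤ _ := by grw [hC φ, ← mul_assoc, hR]

theorem exists_eLpNorm_powerMeasure_le_add (hγ : (N : ℝ) < γ) {ε : ℝ≥0} (hε : 0 < ε) :
    ∃ (t : Finset (EuclideanSpace ℝ (Fin N))) (S : ExteriorTest N →L[ℝ] (t → ℝ)) (C : ℝ≥0),
      ∀ φ : ExteriorTest N, eLpNorm φ N (powerMeasure N γ) ≤ ε * ‖φ‖ₑ + C * ‖S φ‖ₑ := by
  obtain ⟨R, hR⟩ := exists_eLpNorm_restrict_compl_closedBall_le hγ (half_pos hε)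
  obtain ⟨t, S, C, hS⟩ := exists_eLpNorm_restrict_closedBall_le (N := N) R (half_pos hε)
  refine ⟨t, S, C, fun φ => ?_⟩
  set B : Set (EuclideanSpace ℝ (Fin N)) := Metric.closedBall 0 R
  have hB : MeasurableSet B := measurableSet_closedBall
  have hφ : AEStronglyMeasurable φ (powerMeasure N γ) := φ.continuous.aestronglyMeasurable
  calc
    _ = eLpNorm (B.indicator φ + Bᶜ.indicator φ) N (powerMeasure N γ) := by
      rw [Set.indicator_self_add_compl]
    _ ≤ eLpNorm φ N ((powerMeasure N γ).restrict B) +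
        eLpNorm φ N ((powerMeasure N γ).restrict Bᶜ) := by
      rw [← eLpNorm_indicator_eq_eLpNorm_restrict (f := ⇑φ) hB,
        ← eLpNorm_indicator_eq_eLpNorm_restrict (f := ⇑φ) hB.compl]
      exact eLpNorm_add_le (hφ.indicator hB) (hφ.indicator hB.compl) one_le_natCast_dim
    _ ≤ eLpNorm φ N (volume.restrict B) + eLpNorm φ N ((powerMeasure N γ).restrict Bᶜ) := by
      exact add_le_add (eLpNorm_mono_measure φ (Measure.restrict_mono_measure
        (powerMeasure_le_volume (N.cast_nonneg.trans hγ.le)) B)) le_rfl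
    _ ≤ ((ε / 2 : ℝ≥0) * ‖φ‖ₑ + C * ‖S φ‖ₑ) + (ε / 2 : ℝ≥0) * ‖φ‖ₑ := add_le_add (hS φ) (hR φ)
    _ = _ := by rw [add_right_comm, ← add_mul, ← ENNReal.coe_add, add_halves]

end ExteriorTest

theorem eLpNorm_le_eLpNorm_rpow_mul_eLpNorm_rpow {α F : Type*} [MeasurableSpace α]
    [NormedAddCommGroup F] {μ : Measure α} {f : α → F} (hf : AEStronglyMeasurable f μ)
    {p q r : ℝ≥0∞} {θ : ℝ} (hθ0 : 0 < θ) (hθ1 : θ < 1)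
    (h : r⁻¹ = ENNReal.ofReal θ / p + ENNReal.ofReal (1 - θ) / q) :
    eLpNorm f r μ ≤ eLpNorm f p μ ^ θ * eLpNorm f q μ ^ (1 - θ) := by
  have hθ0' : ENNReal.ofReal θ ≠ 0 := (ENNReal.ofReal_pos.2 hθ0).ne'
  have hθ1' : ENNReal.ofReal (1 - θ) ≠ 0 := (ENNReal.ofReal_pos.2 (sub_pos.2 hθ1)).ne'
  have : ENNReal.HolderTriple (p / ENNReal.ofReal θ) (q / ENNReal.ofReal (1 - θ)) r :=
    ⟨by rw [ENNReal.inv_div (.inl ENNReal.ofReal_ne_top) (.inl hθ0'),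
      ENNReal.inv_div (.inl ENNReal.ofReal_ne_top) (.inl hθ1'), h]⟩
  have hsplit : (fun x => ‖f x‖ ^ θ) • (fun x => ‖f x‖ ^ (1 - θ)) = fun x => ‖f x‖ := by
    ext x
    rw [Pi.smul_apply', smul_eq_mul, ← Real.rpow_add_of_nonneg (norm_nonneg _) hθ0.le
      (sub_nonneg.2 hθ1.le), add_sub_cancel, Real.rpow_one]
  have hpow (s : ℝ) (hs : 0 ≤ s) : AEStronglyMeasurable (fun x => ‖f x‖ ^ s) μ :=
    (Real.continuous_rpow_const hs).comp_aestronglyMeasurable hf.norm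
  calc
    eLpNorm f r μ = eLpNorm ((fun x => ‖f x‖ ^ θ) • fun x => ‖f x‖ ^ (1 - θ)) r μ := by
      rw [hsplit, eLpNorm_norm]
    _ ≤ eLpNorm (fun x => ‖f x‖ ^ θ) (p / ENNReal.ofReal θ) μ *
        eLpNorm (fun x => ‖f x‖ ^ (1 - θ)) (q / ENNReal.ofReal (1 - θ)) μ :=
      eLpNorm_smul_le_mul_eLpNorm (hpow _ (sub_nonneg.2 hθ1.le)) (hpow _ hθ0.le)
    _ = eLpNorm f p μ ^ θ * eLpNorm f q μ ^ (1 - θ) := by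
      rw [eLpNorm_norm_rpow _ hθ0, eLpNorm_norm_rpow _ (sub_pos.2 hθ1),
        ENNReal.div_mul_cancel hθ0' ENNReal.ofReal_ne_top,
        ENNReal.div_mul_cancel hθ1' ENNReal.ofReal_ne_top]

theorem exists_interpolation_exponent {r : ℝ≥0∞} (hr1 : 1 ≤ r) (hr : r ≠ ∞) :
    ∃ θ : ℝ, 0 < θ ∧ θ < 1 ∧ ∃ q ≠ ∞,
      r⁻¹ = ENNReal.ofReal θ / 1 + ENNReal.ofReal (1 - θ) / q := by
  lift r to ℝ≥0 using hr
  have hr1' : 1 ≤ (r : ℝ) := by exact_mod_cast hr1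
  have hr0 : 0 < (r : ℝ) := by linarith
  have hq : 0 < 2 * (r : ℝ) - 1 := by linarith
  refine ⟨1 / (2 * r), by positivity, by rw [div_lt_one] <;> linarith,
    ENNReal.ofReal (2 * r - 1), ENNReal.ofReal_ne_top, ?_⟩
  rw [div_one, ← ENNReal.ofReal_div_of_pos hq, ← ENNReal.ofReal_coe_nnreal,
    ← ENNReal.ofReal_inv_of_pos hr0, ← ENNReal.ofReal_add (by positivity)]
  · have hq' : (1 - 1 / (2 * r)) / (2 * r - 1) = 1 / (2 * (r : ℝ)) := by
      rw [div_eq_iff hq.ne']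
      field_simp
    rw [hq']
    congr 1
    field_simp
    norm_num
  · refine div_nonneg (sub_nonneg.2 ?_) hq.le
    rw [div_le_one] <;> linarith

namespace ExteriorTest

variable {N : ℕ} [Fact (2 ≤ N)] {γ : ℝ} {r : ℝ≥0∞}

instance fact_one_le_natCast_dim : Fact (1 ≤ (N : ℝ≥0∞)) :=
  ⟨one_le_natCast_dim⟩

theorem memLp_powerMeasure (hγ : (N : ℝ) < γ) (hr : r ≠ ∞) (φ : ExteriorTest N) :
    MemLp φ r (powerMeasure N γ) := by
  obtain ⟨C, hC⟩ := exists_eLpNorm_powerMeasure_le hγ hr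
  exact ⟨φ.continuous.aestronglyMeasurable,
    (hC φ).trans_lt (ENNReal.mul_lt_top ENNReal.coe_lt_top enorm_lt_top)⟩

theorem exists_eLpNorm_powerMeasure_le_rpow_mul_rpow (hγ : (N : ℝ) < γ) (hr1 : 1 ≤ r)
    (hr : r ≠ ∞) :
    ∃ (C : ℝ≥0) (θ : ℝ), 0 < θ ∧ θ < 1 ∧ ∀ φ : ExteriorTest N,
      eLpNorm φ r (powerMeasure N γ) ≤
        C * eLpNorm φ N (powerMeasure N γ) ^ θ * ‖φ‖ₑ ^ (1 - θ) := by
  have := isFiniteMeasure_powerMeasure hγ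
  obtain ⟨θ, hθ0, hθ1, q, hq, hθ⟩ := exists_interpolation_exponent hr1 hr
  obtain ⟨C, hC⟩ := exists_eLpNorm_le_mul_of_exponent_le (F := ℝ) (powerMeasure N γ)
    (one_le_natCast_dim (N := N))
  obtain ⟨D, hD⟩ := exists_eLpNorm_powerMeasure_le hγ hq
  refine ⟨C ^ θ * D ^ (1 - θ), θ, hθ0, hθ1, fun φ => ?_⟩
  have hφ : AEStronglyMeasurable φ (powerMeasure N γ) := φ.continuous.aestronglyMeasurable
  calc
    _ ≤ eLpNorm φ 1 (powerMeasure N γ) ^ θ * eLpNorm φ q (powerMeasure N γ) ^ (1 - θ) :=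
      eLpNorm_le_eLpNorm_rpow_mul_eLpNorm_rpow hφ hθ0 hθ1 hθ
    _ ≤ (C * eLpNorm φ N (powerMeasure N γ)) ^ θ * (D * ‖φ‖ₑ) ^ (1 - θ) :=
      mul_le_mul' (ENNReal.rpow_le_rpow (hC φ hφ) hθ0.le)
        (ENNReal.rpow_le_rpow (hD φ) (sub_nonneg.2 hθ1.le))
    _ = _ := by
      rw [ENNReal.mul_rpow_of_nonneg _ _ hθ0.le,
        ENNReal.mul_rpow_of_nonneg _ _ (sub_nonneg.2 hθ1.le), mul_mul_mul_comm, ENNReal.coe_mul,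
        ENNReal.coe_rpow_of_nonneg _ hθ0.le, ENNReal.coe_rpow_of_nonneg _ (sub_nonneg.2 hθ1.le),
        mul_assoc _ (eLpNorm φ N _ ^ θ)]

variable [Fact (1 ≤ r)]

/-- The inclusion of the test functions into the Lebesgue space of the model weight. -/
def powerInclusion (hγ : (N : ℝ) < γ) (hr : r ≠ ∞) :
    ExteriorTest N →L[ℝ] Lp ℝ r (powerMeasure N γ) :=
  LinearMap.mkContinuousOfExistsBound
    { toFun φ := (φ.memLp_powerMeasure hγ hr).toLp φ
      map_add' _ _ := MemLp.toLp_add _ _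
      map_smul' _ _ := MemLp.toLp_const_smul _ _ } <| by
    obtain ⟨C, hC⟩ := exists_eLpNorm_powerMeasure_le hγ hr
    refine ⟨C, fun φ => ?_⟩
    have h := hC φ
    rw [← Lp.enorm_toLp (φ.memLp_powerMeasure hγ hr)] at h
    simp only [enorm_eq_nnnorm, ← ENNReal.coe_mul, ENNReal.coe_le_coe] at h
    exact h

theorem powerInclusion_apply (hγ : (N : ℝ) < γ) (hr : r ≠ ∞) (φ : ExteriorTest N) :
    powerInclusion hγ hr φ = (φ.memLp_powerMeasure hγ hr).toLp φ := rfl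

theorem enorm_powerInclusion (hγ : (N : ℝ) < γ) (hr : r ≠ ∞) (φ : ExteriorTest N) :
    ‖powerInclusion hγ hr φ‖ₑ = eLpNorm φ r (powerMeasure N γ) :=
  Lp.enorm_toLp (φ.memLp_powerMeasure hγ hr)

theorem isCompactOperator_powerInclusion_dim (hγ : (N : ℝ) < γ) :
    IsCompactOperator (powerInclusion hγ (ENNReal.natCast_ne_top N)) := by
  refine isCompactOperator_of_forall_exists_norm_le fun ε hε => ?_
  lift ε to ℝ≥0 using hε.le
  obtain ⟨t, S, C, hS⟩ := exists_eLpNorm_powerMeasure_le_add hγ (half_pos (NNReal.coe_pos.1 hε))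
  have hScomp : IsCompactOperator S :=
    ((isCompactOperator_id_iff_finiteDimensional (𝕜 := ℝ) (E := t → ℝ)).2 inferInstance).comp_clm S
  refine ⟨t → ℝ, _, _, S, hScomp, ε / 2 / (C + 1), by positivity, fun φ hφ hSφ => ?_⟩
  have h := hS φ
  rw [← enorm_powerInclusion hγ (ENNReal.natCast_ne_top N)] at h
  simp only [enorm_eq_nnnorm, ← ENNReal.coe_mul, ← ENNReal.coe_add, ENNReal.coe_le_coe] at h
  have hC : C * ‖S φ‖ ≤ ε / 2 := by
    rw [le_div_iff₀ (by positivity)] at hSφ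
    nlinarith [norm_nonneg (S φ)]
  calc
    ‖powerInclusion hγ (ENNReal.natCast_ne_top N) φ‖ ≤ ε / 2 * ‖φ‖ + C * ‖S φ‖ := h
    _ ≤ ε / 2 * 1 + ε / 2 := by gcongr
    _ = ε := by ring

theorem isCompactOperator_powerInclusion (hγ : (N : ℝ) < γ) (hr : r ≠ ∞) :
    IsCompactOperator (powerInclusion hγ hr) := by
  obtain ⟨C, θ, hθ0, hθ1, hC⟩ := exists_eLpNorm_powerMeasure_le_rpow_mul_rpow hγ Fact.out hr
  refine isCompactOperator_of_forall_exists_norm_le fun ε hε => ?_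
  have hlim : Filter.Tendsto (fun δ : ℝ => C * δ ^ θ) (nhdsWithin 0 (Set.Ioi 0)) (nhds 0) := by
    have : Continuous fun δ : ℝ => C * δ ^ θ :=
      continuous_const.mul (Real.continuous_rpow_const hθ0.le)
    simpa only [Real.zero_rpow hθ0.ne', mul_zero] using
      (this.tendsto 0).mono_left nhdsWithin_le_nhds
  obtain ⟨δ, hδε, hδ⟩ := ((hlim.eventually_le_const hε).and self_mem_nhdsWithin).exists
  refine ⟨Lp ℝ N (powerMeasure N γ), _, _, powerInclusion hγ (ENNReal.natCast_ne_top N),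
    isCompactOperator_powerInclusion_dim hγ, δ, hδ, fun φ hφ hφδ => ?_⟩
  have h := hC φ
  rw [← enorm_powerInclusion hγ (ENNReal.natCast_ne_top N), ← enorm_powerInclusion hγ hr] at h
  simp only [enorm_eq_nnnorm, ← ENNReal.coe_rpow_of_nonneg _ hθ0.le,
    ← ENNReal.coe_rpow_of_nonneg _ (sub_nonneg.2 hθ1.le), ← ENNReal.coe_mul,
    ENNReal.coe_le_coe] at h
  calc
    _ ≤ C * ‖powerInclusion hγ (ENNReal.natCast_ne_top N) φ‖ ^ θ * ‖φ‖ ^ (1 - θ) := h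
    _ ≤ C * δ ^ θ * 1 := by
      gcongr
      exact Real.rpow_le_one (norm_nonneg φ) hφ (sub_nonneg.2 hθ1.le)
    _ ≤ ε := by rwa [mul_one]

end ExteriorTest

theorem integral_powerMeasure {N : ℕ} {γ : ℝ} {F : Type*} [NormedAddCommGroup F]
    [NormedSpace ℝ F] (f : EuclideanSpace ℝ (Fin N) → F) :
    ∫ x, f x ∂powerMeasure N γ = ∫ x, ‖x‖ ^ (-γ) • f x ∂exteriorVolume N := by
  rw [powerMeasure, weightedMeasure, integral_withDensity_eq_integral_toReal_smul (by fun_prop)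
    (by simp)]
  congr 1 with x
  rw [ENNReal.toReal_ofReal (by positivity)]

theorem continuous_integral_bilin_Lp {α E F G : Type*} [MeasurableSpace α] {μ : Measure α}
    [NormedAddCommGroup E] [NormedSpace ℝ E] [NormedAddCommGroup F] [NormedSpace ℝ F]
    [NormedAddCommGroup G] [NormedSpace ℝ G] [CompleteSpace G] (B : E →L[ℝ] F →L[ℝ] G) {p q : ℝ≥0∞}
    [p.HolderConjugate q] [Fact (1 ≤ q)] {h : α → E} (hh : MemLp h p μ) :
    Continuous fun f : Lp F q μ => ∫ x, B (h x) (f x) ∂μ := by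
  have : Fact (1 ≤ p) := ⟨ENNReal.HolderConjugate.one_le p q⟩
  convert (B.lpPairing μ p q (hh.toLp h)).continuous with f
  rw [B.lpPairing_eq_integral]
  refine integral_congr_ae ?_
  filter_upwards [hh.coeFn_toLp] with x hx
  rw [hx]

namespace ExteriorTest

variable {N : ℕ}

theorem integral_smul_grad_eq_neg (ψ φ : ExteriorTest N) :
    ∫ x, ψ x • ∇ φ x ∂exteriorVolume N = -∫ x, φ x • ∇ ψ x ∂exteriorVolume N := by
  have hInt (f g : ExteriorTest N) : Integrable (fun x => f x • ∇ g x) volume :=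
    (f.continuous.smul g.continuous_grad).integrable_of_hasCompactSupport
      f.hasCompactSupport.smul_right
  have hset (f g : ExteriorTest N) :
      ∫ x, f x • ∇ g x ∂exteriorVolume N = ∫ x, f x • ∇ g x :=
    setIntegral_eq_integral_of_forall_compl_eq_zero fun x hx => by
      rw [g.grad_eq_zero_of_notMem hx, smul_zero]
  have hinner (v : EuclideanSpace ℝ (Fin N)) (f g : ExteriorTest N) :
      (fun x => inner ℝ v (f x • ∇ g x)) = fun x => f x * fderiv ℝ g x v := by
    ext x
    rw [inner_smul_right, grad_eq, real_inner_comm, InnerProductSpace.toDual_symm_apply]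
  rw [hset, hset]
  refine ext_inner_left ℝ fun v => ?_
  have hInt' (f g : ExteriorTest N) : Integrable (fun x => f x * fderiv ℝ g x v) volume :=
    hinner v f g ▸ (hInt f g).const_inner v
  rw [inner_neg_right, ← integral_inner (hInt ψ φ), ← integral_inner (hInt φ ψ), hinner, hinner,
    integral_mul_fderiv_eq_neg_fderiv_mul_of_integrable]
  · simp only [mul_comm]
  · simpa only [mul_comm] using hInt' φ ψ
  · exact hInt' ψ φ
  · exact (ψ.continuous.mul φ.continuous).integrable_of_hasCompactSupport
      ψ.hasCompactSupport.mul_right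
  · exact fun x _ => ψ.differentiable x
  · exact fun x _ => φ.differentiable x

theorem memLp_norm_rpow_smul_grad {γ : ℝ} (hγ : (N : ℝ) < γ) (p : ℝ≥0∞) (ψ : ExteriorTest N) :
    MemLp (fun x => ‖x‖ ^ γ • ∇ ψ x) p (powerMeasure N γ) := by
  have := isFiniteMeasure_powerMeasure hγ
  have hγ0 : 0 ≤ γ := N.cast_nonneg.trans hγ.le
  exact ((continuous_norm.rpow_const fun _ => .inr hγ0).smul
    ψ.continuous_grad).memLp_of_hasCompactSupport ψ.hasCompactSupport_grad.smul_left

variable [Fact (2 ≤ N)]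

/-- The gradient of a test function, as an isometry into the Lebesgue space `L^N`. -/
def gradLI : ExteriorTest N →ₗᵢ[ℝ] Lp (EuclideanSpace ℝ (Fin N)) N (exteriorVolume N) where
  toFun φ := (φ.memLp_grad N).toLp (∇ φ)
  map_add' φ ψ := by
    rw [← MemLp.toLp_add]
    exact MemLp.toLp_congr _ _ (by rw [grad_add])
  map_smul' c φ := by
    rw [RingHom.id_apply, ← MemLp.toLp_const_smul]
    exact MemLp.toLp_congr _ _ (by rw [grad_smul])
  norm_map' φ := by
    change ‖(φ.memLp_grad N).toLp (∇ φ)‖ = _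
    rw [Lp.norm_toLp, norm_eq_eLpNorm dim_ne_zero]

theorem coeFn_gradLI (φ : ExteriorTest N) : gradLI φ =ᵐ[exteriorVolume N] ∇ φ :=
  (φ.memLp_grad N).coeFn_toLp

end ExteriorTest

namespace BeppoLevi

variable {N : ℕ} [Fact (2 ≤ N)] {γ : ℝ} {r : ℝ≥0∞} [Fact (1 ≤ r)]

/-- The gradient of an element of the Beppo-Levi space, as the continuous extension of the
gradient of test functions. -/
def grad : BeppoLevi N →L[ℝ] Lp (EuclideanSpace ℝ (Fin N)) N (exteriorVolume N) :=
  ExteriorTest.gradLI.toContinuousLinearMap.extend UniformSpace.Completion.toComplL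

theorem grad_coe (φ : ExteriorTest N) : grad (φ : BeppoLevi N) = ExteriorTest.gradLI φ :=
  ContinuousLinearMap.extend_eq _ UniformSpace.Completion.denseRange_coe
    (UniformSpace.Completion.isUniformInducing_coe _) φ

theorem norm_grad (u : BeppoLevi N) : ‖grad u‖ = ‖u‖ := by
  induction u using UniformSpace.Completion.induction_on with
  | hp => exact isClosed_eq (by fun_prop) (by fun_prop)
  | ih φ => rw [grad_coe, LinearIsometry.norm_map, UniformSpace.Completion.norm_coe]

/-- The map from the Beppo-Levi space to the Lebesgue space of the model weight extending the
inclusion of the test functions. -/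
def powerInclusion (hγ : (N : ℝ) < γ) (hr : r ≠ ∞) :
    BeppoLevi N →L[ℝ] Lp ℝ r (powerMeasure N γ) :=
  (ExteriorTest.powerInclusion hγ hr).extend UniformSpace.Completion.toComplL

theorem powerInclusion_coe (hγ : (N : ℝ) < γ) (hr : r ≠ ∞) (φ : ExteriorTest N) :
    powerInclusion hγ hr (φ : BeppoLevi N) = ExteriorTest.powerInclusion hγ hr φ :=
  ContinuousLinearMap.extend_eq _ UniformSpace.Completion.denseRange_coe
    (UniformSpace.Completion.isUniformInducing_coe _) φ

theorem isCompactOperator_powerInclusion (hγ : (N : ℝ) < γ) (hr : r ≠ ∞) :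
    IsCompactOperator (powerInclusion hγ hr) := by
  refine isCompactOperator_of_comp_toComplL ?_
  convert ExteriorTest.isCompactOperator_powerInclusion hγ hr using 1
  ext1 φ
  exact powerInclusion_coe hγ hr φ

theorem integral_smul_grad_eq_neg (hγ : (N : ℝ) < γ) (hr : r ≠ ∞) (ψ : ExteriorTest N)
    (u : BeppoLevi N) :
    ∫ x, ψ x • grad u x ∂exteriorVolume N =
      -∫ x, powerInclusion hγ hr u x • ‖x‖ ^ γ • ∇ ψ x ∂powerMeasure N γ := by
  have hψ : MemLp ψ (ENNReal.conjExponent N) (exteriorVolume N) :=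
    (ψ.continuous.memLp_of_hasCompactSupport ψ.hasCompactSupport).restrict _
  have : (ENNReal.conjExponent N).HolderConjugate N := .symm
  have : r.conjExponent.HolderConjugate r := .symm
  let smulL := ContinuousLinearMap.lsmul (E := EuclideanSpace ℝ (Fin N)) ℝ ℝ
  have hgrad := continuous_integral_bilin_Lp smulL (q := N) hψ
  have hJ := continuous_integral_bilin_Lp smulL.flip (q := r)
    (ψ.memLp_norm_rpow_smul_grad hγ r.conjExponent)
  induction u using UniformSpace.Completion.induction_on with
  | hp =>
    exact isClosed_eq (hgrad.comp grad.continuous) (hJ.comp (powerInclusion hγ hr).continuous).neg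
  | ih φ =>
    calc
      _ = ∫ x, ψ x • ∇ φ x ∂exteriorVolume N := by
        refine integral_congr_ae ?_
        filter_upwards [φ.coeFn_gradLI] with x hx
        rw [grad_coe, hx]
      _ = -∫ x, φ x • ∇ ψ x ∂exteriorVolume N := ψ.integral_smul_grad_eq_neg φ
      _ = -∫ x, φ x • ‖x‖ ^ γ • ∇ ψ x ∂powerMeasure N γ := by
        rw [integral_powerMeasure]
        congr 1
        refine integral_congr_ae ?_
        filter_upwards [one_lt_norm_ae_exteriorVolume] with x hx
        rw [smul_comm (φ x), smul_smul, ← Real.rpow_add (one_pos.trans hx), neg_add_cancel,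
          Real.rpow_zero, one_smul]
      _ = _ := by
        congr 1
        refine integral_congr_ae ?_
        filter_upwards [(φ.memLp_powerMeasure hγ hr).coeFn_toLp] with x hx
        rw [powerInclusion_coe, ExteriorTest.powerInclusion_apply, hx]

theorem injective_powerInclusion (hγ : (N : ℝ) < γ) (hr : r ≠ ∞) :
    Function.Injective (powerInclusion hγ hr : BeppoLevi N →L[ℝ] _) := by
  refine (injective_iff_map_eq_zero _).2 fun u hu => ?_
  have hweak (ψ : ExteriorTest N) : ∫ x, ψ x • grad u x ∂exteriorVolume N = 0 := by
    rw [integral_smul_grad_eq_neg hγ hr, neg_eq_zero]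
    refine integral_eq_zero_of_ae ?_
    filter_upwards [Lp.eq_zero_iff_ae_eq_zero.1 hu] with x hx
    rw [hx, Pi.zero_apply, zero_smul, Pi.zero_apply]
  have hgrad : ∀ᵐ x ∂exteriorVolume N, x ∈ unitBallExterior N → grad u x = 0 :=
    (unitBallExterior N).isOpen.ae_eq_zero_of_integral_contDiff_smul_eq_zero
      (((Lp.memLp (grad u)).locallyIntegrable Fact.out).locallyIntegrableOn _)
      fun g hg hgc hgs => hweak (⟨g, hg, hgc, hgs⟩ : TestFunction _ ℝ ⊤)
  rw [← norm_eq_zero, ← norm_grad, norm_eq_zero, Lp.eq_zero_iff_ae_eq_zero]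
  filter_upwards [hgrad, one_lt_norm_ae_exteriorVolume] with x hx hx1
  exact hx hx1

end BeppoLevi

theorem injective_LpToLpOfMeasureLeSMul {α F : Type*} [MeasurableSpace α] [NormedAddCommGroup F]
    [NormedSpace ℝ F] {μ ν : Measure α} {p c : ℝ≥0∞} [Fact (1 ≤ p)] (hc : c ≠ ∞)
    (h : μ ≤ c • ν) (hνμ : ν ≪ μ) :
    Function.Injective (Lp.LpToLpOfMeasureLeSMul hc h : Lp F p ν →L[ℝ] Lp F p μ) := by
  refine fun f g hfg => Lp.ext (hνμ.ae_eq ?_)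
  calc
    f =ᵐ[μ] Lp.LpToLpOfMeasureLeSMul hc h f := (Lp.coeFn_LpToLpOfMeasureLeSMul hc h f).symm
    _ = Lp.LpToLpOfMeasureLeSMul hc h g := by rw [hfg]
    _ =ᵐ[μ] g := Lp.coeFn_LpToLpOfMeasureLeSMul hc h g

section Weight

variable {N : ℕ} {K : EuclideanSpace ℝ (Fin N) → ℝ}

theorem weightedMeasure_le_smul_powerMeasure {C γ : ℝ}
    (hK : ∀ x, 1 < ‖x‖ → K x ≤ C / ‖x‖ ^ γ) :
    weightedMeasure N K ≤ ENNReal.ofReal C • powerMeasure N γ := by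
  rw [powerMeasure, weightedMeasure, weightedMeasure, ← withDensity_smul _ (by fun_prop)]
  refine withDensity_mono ?_
  filter_upwards [one_lt_norm_ae_exteriorVolume] with x hx
  rw [Pi.smul_apply, smul_eq_mul, ← ENNReal.ofReal_mul' (by positivity),
    Real.rpow_neg (norm_nonneg x), ← div_eq_mul_inv]
  exact ENNReal.ofReal_le_ofReal (hK x hx)

theorem exteriorVolume_absolutelyContinuous_weightedMeasure
    (hK_meas : AEMeasurable K (exteriorVolume N)) (hK_pos : ∀ x, 1 < ‖x‖ → 0 < K x) :
    exteriorVolume N ≪ weightedMeasure N K := by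
  refine withDensity_absolutelyContinuous' hK_meas.ennreal_ofReal ?_
  filter_upwards [one_lt_norm_ae_exteriorVolume] with x hx
  exact (ENNReal.ofReal_pos.2 (hK_pos x hx)).ne'

end Weight

theorem theorem1p2_general {N : ℕ} [Fact (2 ≤ N)] {μ : Measure (EuclideanSpace ℝ (Fin N))}
    (hμ_ac : exteriorVolume N ≪ μ) {c : ℝ≥0∞} (hc : c ≠ ∞) {γ : ℝ} (hγ : (N : ℝ) < γ)
    (hμ_le : μ ≤ c • powerMeasure N γ) {r : ℝ≥0∞} [Fact (1 ≤ r)] (hr : r ≠ ∞) :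
    ∃ ι : BeppoLevi N →L[ℝ] Lp ℝ r μ,
      (∀ φ : ExteriorTest N,
        (ι (φ : BeppoLevi N) : EuclideanSpace ℝ (Fin N) → ℝ) =ᵐ[μ] φ) ∧
      Function.Injective ι ∧
      IsCompactOperator ι := by
  have hac : powerMeasure N γ ≪ μ := (withDensity_absolutelyContinuous _ _).trans hμ_ac
  have hac' : μ ≪ powerMeasure N γ := Measure.absolutelyContinuous_of_le_smul hμ_le
  let J : BeppoLevi N →L[ℝ] Lp ℝ r (powerMeasure N γ) := BeppoLevi.powerInclusion hγ hr
  let Q : Lp ℝ r (powerMeasure N γ) →L[ℝ] Lp ℝ r μ := Lp.LpToLpOfMeasureLeSMul hc hμ_le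
  refine ⟨Q.comp J, fun φ => ?_,
    (injective_LpToLpOfMeasureLeSMul hc hμ_le hac).comp (BeppoLevi.injective_powerInclusion hγ hr),
    (BeppoLevi.isCompactOperator_powerInclusion hγ hr).clm_comp Q⟩
  have hJ : J (φ : BeppoLevi N) =ᵐ[powerMeasure N γ] φ := by
    rw [BeppoLevi.powerInclusion_coe]
    exact (φ.memLp_powerMeasure hγ hr).coeFn_toLp
  exact (Lp.coeFn_LpToLpOfMeasureLeSMul hc hμ_le _).trans (hac'.ae_eq hJ)

end

theorem theorem1p2 (N : ℕ) [Fact (2 ≤ N)]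
    (K : EuclideanSpace ℝ (Fin N) → ℝ)
    (hK_cont : ContinuousOn K {x | 1 < ‖x‖})
    (hK_pos : ∀ x, 1 < ‖x‖ → 0 < K x)
    (hK_decay : ∃ C > (0 : ℝ), ∃ γ > (N : ℝ), ∀ x, 1 < ‖x‖ → K x ≤ C / ‖x‖ ^ γ)
    (r : ℝ≥0∞) [Fact (1 ≤ r)] (hr : r ≠ ∞) :
    ∃ ι : BeppoLevi N →L[ℝ] Lp ℝ r (weightedMeasure N K),
      (∀ φ : ExteriorTest N,
        (ι (φ : BeppoLevi N) : EuclideanSpace ℝ (Fin N) → ℝ) =ᵐ[weightedMeasure N K] φ) ∧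
      Function.Injective ι ∧
      IsCompactOperator ι := by
  obtain ⟨C, -, γ, hγ, hK⟩ := hK_decay
  have hK_meas : AEMeasurable K (exteriorVolume N) :=
    hK_cont.aemeasurable (unitBallExterior N).isOpen.measurableSet
  exact theorem1p2_general (exteriorVolume_absolutelyContinuous_weightedMeasure hK_meas hK_pos)
    ENNReal.ofReal_ne_top hγ (weightedMeasure_le_smul_powerMeasure hK) hr
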